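/- **Theorem.** All vector spaces are over $\mathbb C$. *Setting.* A nonlocal vertex algebra is a vector space $V$ with a linear map $Y(\cdot,x):V\to \mathrm{Hom}(V,V((x)))$ and a vector $\mathbf 1\in V$ such that $Y(\mathbf 1,x)=1$, $Y(v,x)\mathbf 1\in V[[x]]$ with $\lim_{x\to 0}Y(v,x)\mathbf 1=v$ for $v\in V$, and for all $u,v,w\in V$ there is an integer $l\ge 0$ with $$(x_0+x_2)^lY(u,x_0+x_2)Y(v,x_2)w=(x_0+x_2)^lY(Y(u,x_0)v,x_2)w .$$ (Here and below, $f(x\pm y)$ is expanded in nonnegative powers of $y$.) It is nondegenerate if for every integer $n\ge 1$ the linear map $$Z_n:V^{\otimes n}\otimes\mathbb C((x_1))\cdots((x_n))\to V((x_1))\cdots((x_n)),\quad v_1\otimes\cdots\otimes v_n\otimes f\mapsto f\,Y(v_1,x_1)\cdots Y(v_n,x_n)\mathbf 1$$ is injective. The space $\mathrm{Hom}(V,V\otimes\mathbb C((x)))=\mathrm{End}_{\mathbb C((x))}(V\otimes\mathbb C((x)))$ is an associative algebra under composition, with the $\mathbb C$-linear derivation $\partial=\frac{d}{dx}$, where $(\partial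 a)(x)v=\frac{d}{dx}(a(x)v)$ for $v\in V$; $Y$ is extended $\mathbb C((x_1))$-linearly where needed. A subset $U$ of it is $\Delta$-closed if for every $a(x)\in U$ there are $r\ge 0$ and $b_i(x),c_i(x)\in U$ $(1\le i\le r)$ with $$a(x_1)Y(v,x_2)=\sum_{i=1}^rY(b_i(x_1-x_2)v,x_2)\,c_i(x_1)\quad\text{for all }v\in V. \tag{$*$}$$ Let $B(V)$ be the sum of all $\Delta$-closed subspaces $U$ of $\mathrm{Hom}(V,V\otimes\mathbb C((x)))$ such that $a(x)\mathbf 1\in\mathbb C\mathbf 1$ for all $a(x)\in U$. Let $\mathrm{PDer}^-(V)$ be the set of $\psi(x)\in\mathrm{Hom}(V,V\otimes\mathbb C((x)))$ with $[\psi(x_1),Y(v,x_2)]=Y(\psi(x_1-x_2)v,x_2)$ for all $v\in V$, and $\mathrm{PEnd}^-(V)$ the set of $\phi(x)$ with $\phi(x)\mathbf 1=\mathbf 1$ and $\phi(x_1)Y(v,x_2)=Y(\phi(x_1-x_2)v,x_2)\phi(x_1)$ for all $v\in V$. A differential bialgebra is a bialgebra $(B,\Delta,\varepsilon)$ with a derivation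 $\partial$ such that $\varepsilon\circ\partial=0$ and $\Delta\partial=(\partial\otimes 1+1\otimes\partial)\Delta$. *Claim.* Let $V\neq 0$ be a nondegenerate nonlocal vertex algebra. Then $B(V)$ is a unital subalgebra of $\mathrm{Hom}(V,V\otimes\mathbb C((x)))$ closed under $\partial=\frac{d}{dx}$, and it is a differential bialgebra with this $\partial$ and with the counit $\varepsilon$ and the comultiplication $\Delta$ that are uniquely determined as follows: for $a\in B(V)$, $\varepsilon(a)$ is the unique scalar with $a(x)\mathbf 1=\varepsilon(a)\mathbf 1$, and for all finite families $b_i,c_i\in B(V)$ one has $\Delta(a)=\sum_i b_i\otimes c_i$ if and only if $(*)$ holds. Furthermore, $$\mathrm{PDer}^-(V)=\{a\in B(V)\mid\Delta(a)=a\otimes 1+1\otimes a\},\qquad \mathrm{PEnd}^-(V)=\{a\in B(V)\mid a\ne 0,\ \Delta(a)=a\otimes a\}.$$ -/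

import Mathlib

open scoped TensorProduct LaurentSeries

/-! ### Iterated formal Laurent series -/

/-- `IsIterLaurent n f`: the family of coefficients `f : ℤⁿ → M`
(`f p` being the coefficient of `x₁ ^ p₁ ⋯ xₙ ^ pₙ`) is an element of `M((x₁))((x₂))⋯((xₙ))`.
That is: the exponents of the outermost variable `xₙ` are bounded below, and for every `k` the
coefficient of `xₙ ^ k` lies in `M((x₁))⋯((xₙ₋₁))`. -/
def IsIterLaurent {M : Type*} [Zero M] : (n : ℕ) → ((Fin n → ℤ) → M) → Prop
  | 0, _ => True
  | n + 1, f =>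
      (∃ N : ℤ, ∀ (p : Fin n → ℤ) (k : ℤ), k < N → f (Fin.snoc p k) = 0) ∧
        ∀ k : ℤ, IsIterLaurent n (fun p => f (Fin.snoc p k))

theorem IsIterLaurent.zero {M : Type*} [Zero M] :
    ∀ n : ℕ, IsIterLaurent n (fun _ : Fin n → ℤ => (0 : M))
  | 0 => trivial
  | n + 1 => ⟨⟨0, fun _ _ _ => rfl⟩, fun _ => IsIterLaurent.zero n⟩

theorem IsIterLaurent.add {M : Type*} [AddCommGroup M] :
    ∀ (n : ℕ) (f g : (Fin n → ℤ) → M), IsIterLaurent n f → IsIterLaurent n g →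
      IsIterLaurent n (f + g)
  | 0, _, _, _, _ => trivial
  | n + 1, f, g, ⟨⟨N, hN⟩, hf⟩, ⟨⟨N', hN'⟩, hg⟩ =>
      ⟨⟨min N N', fun p k hk => by
        simp [hN p k (lt_of_lt_of_le hk (min_le_left _ _)),
          hN' p k (lt_of_lt_of_le hk (min_le_right _ _))]⟩,
        fun k => IsIterLaurent.add n _ _ (hf k) (hg k)⟩

theorem IsIterLaurent.smul {M : Type*} [AddCommGroup M] [Module ℂ M] (c : ℂ) :
    ∀ (n : ℕ) (f : (Fin n → ℤ) → M), IsIterLaurent n f → IsIterLaurent n (c • f)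
  | 0, _, _ => trivial
  | n + 1, f, ⟨⟨N, hN⟩, hf⟩ =>
      ⟨⟨N, fun p k hk => by simp [hN p k hk]⟩, fun k => IsIterLaurent.smul c n _ (hf k)⟩

/-- The vector space `M((x₁))((x₂))⋯((xₙ))`. -/
def iterLaurent (M : Type*) [AddCommGroup M] [Module ℂ M] (n : ℕ) :
    Submodule ℂ ((Fin n → ℤ) → M) where
  carrier := {f | IsIterLaurent n f}
  zero_mem' := IsIterLaurent.zero n
  add_mem' hf hg := IsIterLaurent.add n _ _ hf hg
  smul_mem' c _ hf := IsIterLaurent.smul c n _ hf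

theorem IsIterLaurent.finite_mul {M : Type*} [AddCommGroup M] :
    ∀ (n : ℕ) (f : (Fin n → ℤ) → ℂ) (F : (Fin n → ℤ) → M), IsIterLaurent n f →
      IsIterLaurent n F → ∀ m : Fin n → ℤ, {p | f p ≠ 0 ∧ F (m - p) ≠ 0}.Finite
  | 0, _, _, _, _, _ => Set.toFinite _
  | n + 1, f, F, ⟨⟨N, hN⟩, hf⟩, ⟨⟨N', hN'⟩, hF⟩, m => by
      have key : ∀ k : ℤ, {q : Fin n → ℤ | f (Fin.snoc q k) ≠ 0 ∧
          F (Fin.snoc (Fin.init m - q) (m (Fin.last n) - k)) ≠ 0}.Finite := fun k =>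
        IsIterLaurent.finite_mul n _ _ (hf k) (hF (m (Fin.last n) - k)) (Fin.init m)
      refine ((Set.finite_Icc N (m (Fin.last n) - N')).biUnion
        (fun k _ => (key k).image (fun q => (Fin.snoc q k : Fin (n + 1) → ℤ)))).subset ?_
      rintro p ⟨h1, h2⟩
      have hp : p = Fin.snoc (Fin.init p) (p (Fin.last n)) := (Fin.snoc_init_self p).symm
      have hmp : m - p =
          Fin.snoc (Fin.init m - Fin.init p) (m (Fin.last n) - p (Fin.last n)) := by
        rw [← Fin.snoc_init_self (m - p)]; rfl
      simp only [Set.mem_iUnion, Set.mem_image]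
      refine ⟨p (Fin.last n), ⟨?_, ?_⟩, Fin.init p, ⟨?_, ?_⟩, hp.symm⟩
      · by_contra hlt
        exact h1 (by rw [hp]; exact hN _ _ (not_le.mp hlt))
      · by_contra hlt
        have hlt' : m (Fin.last n) - p (Fin.last n) < N' := by linarith [not_le.mp hlt]
        exact h2 (by rw [hmp]; exact hN' _ _ hlt')
      · rw [← hp]; exact h1
      · rw [← hmp]; exact h2

theorem IsIterLaurent.finite_support {M : Type*} [AddCommGroup M] [Module ℂ M] {n : ℕ}
    (f : iterLaurent ℂ n) (F : iterLaurent M n) (m : Fin n → ℤ) :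
    (Function.support fun p => f.1 p • F.1 (m - p)).Finite :=
  (IsIterLaurent.finite_mul n f.1 F.1 f.2 F.2 m).subset fun p hp =>
    ⟨fun h => hp (by simp [h]), fun h => hp (by simp [h])⟩

/-- The product `f F` of a scalar series `f ∈ ℂ((x₁))⋯((xₙ))` with `F ∈ M((x₁))⋯((xₙ))`: the
coefficient at the exponent `m` is the (finite) sum `∑ₚ fₚ F_{m - p}`. -/
noncomputable def iterLaurentMul (M : Type*) [AddCommGroup M] [Module ℂ M] (n : ℕ) :
    iterLaurent ℂ n →ₗ[ℂ] iterLaurent M n →ₗ[ℂ] ((Fin n → ℤ) → M) :=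
  LinearMap.mk₂ ℂ (fun f F m => ∑ᶠ p, f.1 p • F.1 (m - p))
    (fun f g F => by
      funext m
      simp only [Submodule.coe_add, Pi.add_apply, add_smul]
      exact finsum_add_distrib (IsIterLaurent.finite_support f F m)
        (IsIterLaurent.finite_support g F m))
    (fun c f F => by
      funext m
      simp only [Submodule.coe_smul, Pi.smul_apply, smul_assoc]
      exact (smul_finsum' c (IsIterLaurent.finite_support f F m)).symm)
    (fun f F G => by
      funext m
      simp only [Submodule.coe_add, Pi.add_apply, smul_add]
      exact finsum_add_distrib (IsIterLaurent.finite_support f F m)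
        (IsIterLaurent.finite_support f G m))
    (fun c f F => by
      funext m
      simp only [Submodule.coe_smul, Pi.smul_apply, smul_comm _ c]
      exact (smul_finsum' c (IsIterLaurent.finite_support f F m)).symm)

/-! ### Nonlocal vertex algebras -/

/-- Multiplication of a two-variable formal series `∑ F i j x₀ⁱ x₂ʲ` by `x₀ + x₂`. -/
def mulAddVars {M : Type*} [AddCommGroup M] (F : ℤ → ℤ → M) : ℤ → ℤ → M :=
  fun i j => F (i - 1) j + F i (j - 1)

/-- The coefficient of `x₀ⁱ x₂ʲ` in `Y(u, x₀ + x₂) Y(v, x₂) w`, where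
`Y(u, x₀ + x₂) = ∑ₖ (1/k!) (d/dx₀)ᵏ Y(u, x₀) x₂ᵏ` is expanded in nonnegative powers of `x₂`.
The sum over `k` is finite since `Y(v, x₂) w ∈ V((x₂))`. -/
noncomputable def shiftedProduct {V : Type*} [AddCommGroup V] [Module ℂ V]
    (Y : V →ₗ[ℂ] V →ₗ[ℂ] LaurentSeries V) (u v w : V) : ℤ → ℤ → V :=
  fun i j => ∑ᶠ k : ℕ, (LaurentSeries.hasseDeriv ℂ k (Y u ((Y v w).coeff (j - k)))).coeff i

/-- The coefficient of `x₀ⁱ x₂ʲ` in `Y(Y(u, x₀) v, x₂) w`. -/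
def iteratedProduct {V : Type*} [AddCommGroup V] [Module ℂ V]
    (Y : V →ₗ[ℂ] V →ₗ[ℂ] LaurentSeries V) (u v w : V) : ℤ → ℤ → V :=
  fun i j => (Y ((Y u v).coeff i) w).coeff j

/-- A nonlocal vertex algebra structure on a complex vector space `V`. The coefficient of `xⁿ` in
`Y(v, x) w` is `(Y v w).coeff n`. -/
structure NonlocalVertexAlgebra (V : Type*) [AddCommGroup V] [Module ℂ V] where
  /-- the vertex operator map `v ↦ Y(v, x) ∈ Hom(V, V((x)))` -/
  Y : V →ₗ[ℂ] V →ₗ[ℂ] LaurentSeries V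
  /-- the vacuum vector `𝟏` -/
  vac : V
  /-- `Y(𝟏, x) = 1` -/
  vac_left : ∀ v : V, Y vac v = HahnSeries.single 0 v
  /-- `Y(v, x) 𝟏 ∈ V[[x]]` -/
  creation_nonneg : ∀ (v : V) (n : ℤ), n < 0 → (Y v vac).coeff n = 0
  /-- `Y(v, x) 𝟏` has constant term `v` -/
  creation_zero : ∀ v : V, (Y v vac).coeff 0 = v
  /-- weak associativity: for some `l`,
  `(x₀ + x₂)ˡ Y(u, x₀ + x₂) Y(v, x₂) w = (x₀ + x₂)ˡ Y(Y(u, x₀) v, x₂) w` -/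
  weak_assoc : ∀ u v w : V, ∃ l : ℕ,
    mulAddVars^[l] (shiftedProduct Y u v w) = mulAddVars^[l] (iteratedProduct Y u v w)

/-! ### The algebra `Hom(V, V ⊗ ℂ((x)))` -/

/-- The field `ℂ((x))` of formal Laurent series, with its coefficientwise structure of
`ℂ`-algebra. (A separate name is needed because Mathlib has a second, not definitionally equal,
instance of `ℂ`-algebra on `LaurentSeries ℂ`.) -/
def ScalarLaurent : Type := LaurentSeries ℂ

noncomputable instance : Field ScalarLaurent := inferInstanceAs (Field (LaurentSeries ℂ))

noncomputable instance : Algebra ℂ ScalarLaurent :=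
  (HahnSeries.instAlgebra : Algebra ℂ (HahnSeries ℤ ℂ))

/-- `(1/k!) (d/dx)ᵏ` on `ℂ((x))`. -/
noncomputable def ScalarLaurent.divDeriv (k : ℕ) : ScalarLaurent →ₗ[ℂ] ScalarLaurent :=
  (LaurentSeries.hasseDeriv ℂ k : LaurentSeries ℂ →ₗ[ℂ] LaurentSeries ℂ)

/-- The space `Hom_ℂ(V, V ⊗ ℂ((x)))`, identified with `End_{ℂ((x))}(V ⊗ ℂ((x)))`
(see `LinearMap.liftBaseChangeEquiv`): `a(x)` is determined by the values `a(x) v = a (1 ⊗ₜ v)`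
for `v : V`. It is an algebra under composition. The factor `ℂ((x))` is written on the left. -/
abbrev LaurentHom (V : Type*) [AddCommGroup V] [Module ℂ V] : Type _ :=
  Module.End ScalarLaurent (ScalarLaurent ⊗[ℂ] V)

/-- `(1/k!) (d/dx)ᵏ` on `V ⊗ ℂ((x))`. -/
noncomputable def divDeriv (V : Type*) [AddCommGroup V] [Module ℂ V] (k : ℕ) :
    ScalarLaurent ⊗[ℂ] V →ₗ[ℂ] ScalarLaurent ⊗[ℂ] V :=
  LinearMap.rTensor V (ScalarLaurent.divDeriv k)

/-- The formal derivative `d/dx a(x)`: the map with `(d/dx a(x)) v = d/dx (a(x) v)` for `v : V`. -/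
noncomputable def LaurentHom.ddx {V : Type*} [AddCommGroup V] [Module ℂ V] (a : LaurentHom V) :
    LaurentHom V :=
  LinearMap.liftBaseChange ScalarLaurent
    (divDeriv V 1 ∘ₗ a.restrictScalars ℂ ∘ₗ TensorProduct.mk ℂ ScalarLaurent V 1)

namespace NonlocalVertexAlgebra

variable {V : Type*} [AddCommGroup V] [Module ℂ V] (𝒱 : NonlocalVertexAlgebra V)

/-! ### Nondegeneracy -/

/-- The coefficient of `x₁ ^ p₁ ⋯ xₙ ^ pₙ` in `Y(v₁, x₁) ⋯ Y(vₙ, xₙ) w`. -/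
noncomputable def prodCoeff : (n : ℕ) → (Fin n → V) → (Fin n → ℤ) → V →ₗ[ℂ] V
  | 0, _, _ => LinearMap.id
  | n + 1, v, p =>
      prodCoeff n (Fin.init v) (Fin.init p) ∘ₗ
        { toFun := fun w => (𝒱.Y (v (Fin.last n)) w).coeff (p (Fin.last n))
          map_add' := fun _ _ => by simp
          map_smul' := fun _ _ => by simp }

theorem prodCoeff_isIterLaurent : ∀ (n : ℕ) (v : Fin n → V) (w : V),
    IsIterLaurent n (fun p => 𝒱.prodCoeff n v p w)
  | 0, _, _ => trivial
  | n + 1, v, w => by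
      refine ⟨⟨(𝒱.Y (v (Fin.last n)) w).order, fun p k hk => ?_⟩, fun k => ?_⟩
      · simp [prodCoeff, HahnSeries.coeff_eq_zero_of_lt_order hk]
      · simpa [prodCoeff] using
          prodCoeff_isIterLaurent n (Fin.init v) ((𝒱.Y (v (Fin.last n)) w).coeff k)

theorem prodCoeff_update_add : ∀ (n : ℕ) (v : Fin n → V) (i : Fin n)
    (x y : V) (p : Fin n → ℤ) (w : V),
    𝒱.prodCoeff n (Function.update v i (x + y)) p w =
      𝒱.prodCoeff n (Function.update v i x) p w + 𝒱.prodCoeff n (Function.update v i y) p w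
  | 0, _, i, _, _, _, _ => i.elim0
  | n + 1, v, i, x, y, p, w => by
      induction i using Fin.lastCases with
      | last => simp [prodCoeff, Fin.init_update_last]
      | cast i =>
        simp only [prodCoeff, Fin.init_update_castSucc, LinearMap.comp_apply]
        have h : ∀ z : V, Function.update v i.castSucc z (Fin.last n) = v (Fin.last n) :=
          fun z => Function.update_of_ne (Fin.castSucc_lt_last i).ne' _ _
        simp only [h]
        exact prodCoeff_update_add n _ i x y _ _

theorem prodCoeff_update_smul : ∀ (n : ℕ) (v : Fin n → V) (i : Fin n)
    (c : ℂ) (x : V) (p : Fin n → ℤ) (w : V),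
    𝒱.prodCoeff n (Function.update v i (c • x)) p w =
      c • 𝒱.prodCoeff n (Function.update v i x) p w
  | 0, _, i, _, _, _, _ => i.elim0
  | n + 1, v, i, c, x, p, w => by
      induction i using Fin.lastCases with
      | last => simp [prodCoeff, Fin.init_update_last]
      | cast i =>
        simp only [prodCoeff, Fin.init_update_castSucc, LinearMap.comp_apply]
        have h : ∀ z : V, Function.update v i.castSucc z (Fin.last n) = v (Fin.last n) :=
          fun z => Function.update_of_ne (Fin.castSucc_lt_last i).ne' _ _
        simp only [h]
        exact prodCoeff_update_smul n _ i c x _ _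

/-- The multilinear map `(v₁, …, vₙ) ↦ Y(v₁, x₁) ⋯ Y(vₙ, xₙ) 𝟏 ∈ V((x₁))⋯((xₙ))`. -/
noncomputable def vertexProd (n : ℕ) :
    MultilinearMap ℂ (fun _ : Fin n => V) (iterLaurent V n) where
  toFun v := ⟨fun p => 𝒱.prodCoeff n v p 𝒱.vac, 𝒱.prodCoeff_isIterLaurent n v 𝒱.vac⟩
  map_update_add' {inst} v i x y := by
    obtain rfl := Subsingleton.elim inst (instDecidableEqFin n)
    exact Subtype.ext (funext fun p => 𝒱.prodCoeff_update_add n v i x y p 𝒱.vac)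
  map_update_smul' {inst} v i c x := by
    obtain rfl := Subsingleton.elim inst (instDecidableEqFin n)
    exact Subtype.ext (funext fun p => 𝒱.prodCoeff_update_smul n v i c x p 𝒱.vac)

/-- The map `Zₙ : V^{⊗n} ⊗ ℂ((x₁))⋯((xₙ)) → V((x₁))⋯((xₙ))`,
`v₁ ⊗ ⋯ ⊗ vₙ ⊗ f ↦ f Y(v₁, x₁) ⋯ Y(vₙ, xₙ) 𝟏`, with values written as families of
coefficients. -/
noncomputable def Z (n : ℕ) :
    (⨂[ℂ] _ : Fin n, V) ⊗[ℂ] iterLaurent ℂ n →ₗ[ℂ] ((Fin n → ℤ) → V) :=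
  TensorProduct.lift
    (PiTensorProduct.lift ((iterLaurentMul V n).flip.compMultilinearMap (𝒱.vertexProd n)))

/-- `V` is nondegenerate if `Zₙ` is injective for every positive integer `n`. -/
def Nondegenerate : Prop := ∀ n : ℕ, 0 < n → Function.Injective (𝒱.Z n)

/-! ### Pseudo derivations, pseudo endomorphisms and `B(V)` -/

/-- The coefficient of `x₂ʲ` in `Y(m, x₂) m'` for `m, m' ∈ V ⊗ ℂ((x₁))`, where `Y` is extended
`ℂ((x₁))`-bilinearly. -/
noncomputable def coeffK (j : ℤ) :
    ScalarLaurent ⊗[ℂ] V →ₗ[ℂ] ScalarLaurent ⊗[ℂ] V →ₗ[ℂ] ScalarLaurent ⊗[ℂ] V :=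
  TensorProduct.map₂ (LinearMap.mul ℂ (ScalarLaurent))
    (LinearMap.mk₂ ℂ (fun u w => (𝒱.Y u w).coeff j) (fun _ _ _ => by simp) (fun _ _ _ => by simp)
      (fun _ _ _ => by simp) (fun _ _ _ => by simp))

/-- The coefficient of `x₂ʲ` in `Y(m(x₁ - x₂), x₂) m'(x₁)` for `m, m' ∈ V ⊗ ℂ((x))`, where
`m(x₁ - x₂) = ∑ₖ ((-1)ᵏ/k!) (d/dx₁)ᵏ m(x₁) x₂ᵏ` is expanded in nonnegative powers of `x₂`.
The sum over `k` is finite. -/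
noncomputable def shiftCoeff (m m' : ScalarLaurent ⊗[ℂ] V) (j : ℤ) : ScalarLaurent ⊗[ℂ] V :=
  ∑ᶠ k : ℕ, (-1 : ℂ) ^ k • 𝒱.coeffK (j - k) (divDeriv V k m) m'

/-- `PDer⁻(V)`: the `ψ(x)` with `[ψ(x₁), Y(v, x₂)] = Y(ψ(x₁ - x₂) v, x₂)` for all `v`. -/
def PDerMinus : Set (LaurentHom V) :=
  {ψ | ∀ (v w : V) (j : ℤ),
    ψ (1 ⊗ₜ (𝒱.Y v w).coeff j) - 𝒱.coeffK j (1 ⊗ₜ v) (ψ (1 ⊗ₜ w)) =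
      𝒱.shiftCoeff (ψ (1 ⊗ₜ v)) (1 ⊗ₜ w) j}

/-- `PEnd⁻(V)`: the `φ(x)` with `φ(x) 𝟏 = 𝟏` and
`φ(x₁) Y(v, x₂) = Y(φ(x₁ - x₂) v, x₂) φ(x₁)` for all `v`. -/
def PEndMinus : Set (LaurentHom V) :=
  {φ | φ (1 ⊗ₜ 𝒱.vac) = 1 ⊗ₜ 𝒱.vac ∧ ∀ (v w : V) (j : ℤ),
    φ (1 ⊗ₜ (𝒱.Y v w).coeff j) = 𝒱.shiftCoeff (φ (1 ⊗ₜ v)) (φ (1 ⊗ₜ w)) j}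

/-- The relation `a(x₁) Y(v, x₂) = ∑ᵢ Y(bᵢ(x₁ - x₂) v, x₂) cᵢ(x₁)` for all `v`. -/
def IsCoproduct (a : LaurentHom V) {r : ℕ} (b c : Fin r → LaurentHom V) : Prop :=
  ∀ (v w : V) (j : ℤ),
    a (1 ⊗ₜ (𝒱.Y v w).coeff j) = ∑ i, 𝒱.shiftCoeff (b i (1 ⊗ₜ v)) (c i (1 ⊗ₜ w)) j

/-- `Δ`-closed subsets of `Hom(V, V ⊗ ℂ((x)))`. -/
def DeltaClosed (U : Set (LaurentHom V)) : Prop :=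
  ∀ a ∈ U, ∃ (r : ℕ) (b c : Fin r → LaurentHom V),
    (∀ i, b i ∈ U) ∧ (∀ i, c i ∈ U) ∧ 𝒱.IsCoproduct a b c

/-- `B(V)`: the sum of all `Δ`-closed subspaces `U` of `Hom(V, V ⊗ ℂ((x)))` with
`a(x) 𝟏 ∈ ℂ 𝟏` for all `a(x) ∈ U`. -/
noncomputable def B : Submodule ℂ (LaurentHom V) :=
  sSup {U : Submodule ℂ (LaurentHom V) | 𝒱.DeltaClosed (U : Set (LaurentHom V)) ∧
    ∀ a ∈ U, ∃ c : ℂ, a (1 ⊗ₜ 𝒱.vac) = c • ((1 : ScalarLaurent) ⊗ₜ[ℂ] 𝒱.vac)}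

end NonlocalVertexAlgebra

/-! ### Differential bialgebras -/

/-- A differential bialgebra structure on a unital associative algebra `A`: a coalgebra structure
whose comultiplication and counit are algebra homomorphisms, and a derivation `∂` with `ε ∂ = 0`
and `Δ ∂ = (∂ ⊗ 1 + 1 ⊗ ∂) Δ`. -/
structure DifferentialBialgebra (A : Type*) [Semiring A] [Algebra ℂ A] extends Coalgebra ℂ A where
  comul_one : comul (1 : A) = 1
  comul_mul : ∀ a b : A, comul (a * b) = comul a * comul b
  counit_one : counit (1 : A) = 1
  counit_mul : ∀ a b : A, counit (a * b) = counit a * counit b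
  /-- the derivation `∂` -/
  der : A →ₗ[ℂ] A
  der_mul : ∀ a b : A, der (a * b) = der a * b + a * der b
  counit_der : ∀ a : A, counit (der a) = 0
  comul_der : ∀ a : A, comul (der a) = der.rTensor A (comul a) + der.lTensor A (comul a)

/-! ### Formal calculus in two variables -/

section FormalCalculus

/-! Call t = Σ bᵢ ⊗ cᵢ a coproduct of a when (∗) holds (`IsCoproductTensor`). Everything rests on
one injectivity statement: for nondegenerate V, the maps sending m ⊗ m' to the coefficients in x₂ of
Y(m(x₁ - x₂), x₂) m'(x₁) have no common kernel on the tensor square of V ⊗ ℂ((x))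
(`eq_zero_of_shiftTensor_eq_zero`). So coproducts are unique, and an identity for Δ follows once
both sides are coproducts of the same operator: composing operators multiplies coproducts
(`IsCoproductTensor.mul`), and differentiating (∗) in x₁ gives the formula for Δ∂
(`IsCoproductTensor.ddx`).

Injectivity has two inputs. First, for a basis e the series Y(eₚ, x) e_q are independent over ℂ[[x]]
(`eq_zero_of_sum_Y`). From Σ φ(x₀) Y(Y(u, x₀)v, x₂)𝟏 = 0, weak associativity and cancellation of a
power of x₀ + x₂ give Σ φ(x₀) Y(u, x₀ + x₂) Y(v, x₂)𝟏 = 0; undoing x₁ = x₀ + x₂ gives Σ φ(x₁ - x₂)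
Y(u, x₁) Y(v, x₂)𝟏 = 0, and Z₂ is injective. Second, Σ f ⊗ g in ℂ((x)) ⊗ ℂ((x)) vanishes as soon as
Σ f⁽ᵏ⁾ g = 0 for all k, by a Wronskian argument (`ScalarLaurent.eq_zero_of_mul_divDeriv_tensor`).

For coassociativity, (Δ ⊗ 1)Δ(a) and (1 ⊗ Δ)Δ(a) compute a on the iterated and on the nested product
of u, v, w. Weak associativity relates these two products, and its version with Laurent coefficients
(`weak_assoc_shift`) relates the two expansions; after cancelling a power of x₀ + x₂, joint
injectivity used twice concludes (`coassoc_apply`). The counit identities come from v = 𝟏 and w = 𝟏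
in (∗).

Finally, `coproductSubmodule` is monotone and B(V) is the greatest U with U ≤ `coproductSubmodule
U`. Membership in B(V) is therefore shown by exhibiting such a U: B · B for products, B + ∂B for
derivatives, the span of ψ and 1 for pseudo derivations, the line of φ for pseudo endomorphisms. -/

theorem finsum_eq_sum_range {M : Type*} [AddCommMonoid M] {g : ℕ → M} (n : ℕ)
    (h : ∀ k, n ≤ k → g k = 0) : ∑ᶠ k, g k = ∑ k ∈ Finset.range n, g k := by
  refine finsum_eq_sum_of_support_subset g fun k hk => ?_
  simp only [Finset.coe_range, Set.mem_Iio]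
  by_contra hn
  exact hk (h k (not_lt.mp hn))

theorem finsum_antidiagonal {M : Type*} [AddCommMonoid M] {g : ℕ → ℕ → M} (n : ℕ)
    (h : ∀ k l, n ≤ k + l → g k l = 0) :
    ∑ᶠ a, ∑ p ∈ Finset.HasAntidiagonal.antidiagonal a, g p.1 p.2 = ∑ᶠ k, ∑ᶠ l, g k l := by
  have h1 : ∀ k, ∑ᶠ l, g k l = ∑ l ∈ Finset.range n, g k l := fun k =>
    finsum_eq_sum_range n fun l hl => h k l (by lia)
  rw [finsum_eq_sum_range (g := fun a => ∑ p ∈ Finset.HasAntidiagonal.antidiagonal a, g p.1 p.2) n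
      fun a ha => Finset.sum_eq_zero fun p hp => h _ _ (by
        rw [Finset.HasAntidiagonal.mem_antidiagonal] at hp; lia),
    finsum_congr h1, finsum_eq_sum_range n fun k hk => Finset.sum_eq_zero fun l _ =>
      h k l (by lia)]
  rw [Finset.sum_sigma', ← Finset.sum_product']
  refine Finset.sum_of_injOn (fun x => x.2) ?_ ?_ ?_ ?_
  · rintro ⟨a, p⟩ h1 ⟨b, q⟩ h2 h3
    simp only [Finset.coe_sigma, Set.mem_sigma_iff, Finset.mem_coe,
      Finset.HasAntidiagonal.mem_antidiagonal] at h1 h2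
    simp only at h3
    subst h3
    obtain rfl : a = b := by rw [← h1.2, ← h2.2]
    rfl
  · rintro ⟨a, p⟩ h1
    simp only [Finset.coe_sigma, Set.mem_sigma_iff, Finset.mem_coe,
      Finset.HasAntidiagonal.mem_antidiagonal, Finset.mem_range] at h1
    simp only [Finset.coe_product, Finset.coe_range, Set.mem_prod, Set.mem_Iio]
    lia
  · rintro ⟨k, l⟩ _ h2
    refine h k l ?_
    by_contra hn
    exact h2 ⟨⟨k + l, (k, l)⟩, by simp; lia, rfl⟩
  · intros; rfl

/-- A two-variable series all of whose coefficients below a given exponent vanish in large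
degree. -/
def DegreeFinite {M : Type*} [Zero M] (F : ℤ → ℤ → M) : Prop :=
  ∀ i j : ℤ, ∃ n : ℕ, ∀ k l : ℕ, n ≤ k + l → F (i - k) (j - l) = 0

/-- The exponents of the second variable are bounded below. -/
def SecondBounded {M : Type*} [Zero M] (F : ℤ → ℤ → M) : Prop :=
  ∃ J : ℤ, ∀ i j : ℤ, j < J → F i j = 0

/-- The exponents of the first variable are bounded below. -/
def FirstBounded {M : Type*} [Zero M] (F : ℤ → ℤ → M) : Prop :=
  ∃ I : ℤ, ∀ i j : ℤ, i < I → F i j = 0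

/-- Only the finitely many l ≤ j - J matter, and for each of them the exponents of the first
variable are bounded below; summing these bounds over l gives one threshold. -/
theorem DegreeFinite.of_second {M : Type*} [Zero M] {F : ℤ → ℤ → M} (h : SecondBounded F)
    (h' : ∀ j, ∃ I : ℤ, ∀ i, i < I → F i j = 0) : DegreeFinite F := by
  obtain ⟨J, hJ⟩ := h
  choose I hI using h'
  intro i j
  refine ⟨(j - J).toNat + 1 + ∑ l ∈ Finset.range ((j - J).toNat + 1), ((i - I (j - l)).toNat + 1),
    fun k l hkl => ?_⟩
  by_cases hl : j - l < J
  · exact hJ _ _ hl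
  · apply hI
    have hl' : l ∈ Finset.range ((j - J).toNat + 1) := by simp; lia
    have := Finset.single_le_sum (f := fun l : ℕ => (i - I (j - l)).toNat + 1)
      (fun _ _ => Nat.zero_le _) hl'
    simp only [Finset.mem_range] at hl'
    lia

theorem DegreeFinite.of_first {M : Type*} [Zero M] {F : ℤ → ℤ → M} (h : FirstBounded F)
    (h' : ∀ i, ∃ J : ℤ, ∀ j, j < J → F i j = 0) : DegreeFinite F := by
  intro i j
  obtain ⟨n, hn⟩ := DegreeFinite.of_second (F := fun a b => F b a) (h.imp fun I hI i j hj => hI j i hj) h' j i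
  exact ⟨n, fun k l hkl => hn l k (by lia)⟩

/-! ### Powers of a linear form and the substitution x₀ ↦ x₀ + x₂ -/

variable {R M : Type*} [CommRing R] [AddCommGroup M] [Module R M]

/-- Multiplication of a two-variable series by `α x₀ + β x₂`. -/
def linMul (α β : R) : Module.End R (ℤ → ℤ → M) where
  toFun F i j := α • F (i - 1) j + β • F i (j - 1)
  map_add' F G := by funext i j; simp only [Pi.add_apply, smul_add]; abel
  map_smul' c F := by
    funext i j
    simp only [Pi.smul_apply, smul_add, RingHom.id_apply, smul_comm c]

theorem linMul_apply (α β : R) (F : ℤ → ℤ → M) (i j : ℤ) :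
    linMul α β F i j = α • F (i - 1) j + β • F i (j - 1) := rfl

theorem linMul_one_one (F : ℤ → ℤ → M) : linMul (1 : R) 1 F = mulAddVars F := by
  funext i j; simp [linMul_apply, mulAddVars]

theorem linMul_commute (α β α' β' : R) :
    Commute (linMul α β : Module.End R (ℤ → ℤ → M)) (linMul α' β') := by
  refine LinearMap.ext fun F => ?_
  funext i j
  simp only [Module.End.mul_apply, linMul_apply, smul_add, smul_smul, mul_comm α', mul_comm β']
  abel

theorem linMul_pow_eq_zero (α β : R) : ∀ (a : ℕ) (F : ℤ → ℤ → M) (i j : ℤ),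
    (∀ k l : ℕ, k + l = a → F (i - k) (j - l) = 0) → ((linMul α β) ^ a) F i j = 0
  | 0, F, i, j, h => by simpa using h 0 0 rfl
  | a + 1, F, i, j, h => by
    rw [pow_succ, Module.End.mul_apply]
    refine linMul_pow_eq_zero α β a _ i j fun k l hkl => ?_
    have h1 := h (k + 1) l (by lia)
    have h2 := h k (l + 1) (by lia)
    push_cast at h1 h2
    simp only [linMul_apply, sub_sub, h1, h2, smul_zero, add_zero]

theorem linMul_one_zero_pow (k : ℕ) (F : ℤ → ℤ → M) (i j : ℤ) :
    ((linMul (1 : R) 0) ^ k) F i j = F (i - k) j := by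
  induction k generalizing F with
  | zero => simp
  | succ k ih =>
    rw [pow_succ, Module.End.mul_apply, ih]
    simp [linMul_apply, sub_sub]

theorem linMul_zero_one_pow (k : ℕ) (F : ℤ → ℤ → M) (i j : ℤ) :
    ((linMul (0 : R) 1) ^ k) F i j = F i (j - k) := by
  induction k generalizing F with
  | zero => simp
  | succ k ih =>
    rw [pow_succ, Module.End.mul_apply, ih]
    simp [linMul_apply, sub_sub]

/-- The binomial theorem for the commuting multiplications by x₀ and x₂. -/
theorem linMul_pow_apply (α β : R) (a : ℕ) (F : ℤ → ℤ → M) (i j : ℤ) :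
    ((linMul α β) ^ a) F i j =
      ∑ p ∈ Finset.HasAntidiagonal.antidiagonal a, (a.choose p.1 • (α ^ p.1 * β ^ p.2)) • F (i - p.1) (j - p.2) := by
  have h0 : (linMul α β : Module.End R (ℤ → ℤ → M)) = α • linMul 1 0 + β • linMul 0 1 := by
    refine LinearMap.ext fun F => ?_
    funext i j
    simp [linMul_apply]
  rw [h0, (((linMul_commute 1 0 0 1).smul_left α).smul_right β).add_pow']
  simp only [LinearMap.sum_apply, Finset.sum_apply]
  refine Finset.sum_congr rfl fun p _ => ?_
  simp only [smul_pow, LinearMap.smul_apply, Pi.smul_apply, smul_mul_smul_comm, Module.End.mul_apply,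
    linMul_one_zero_pow, linMul_zero_one_pow, smul_assoc]

theorem DegreeFinite.linMul {F : ℤ → ℤ → M} (h : DegreeFinite F) (α β : R) :
    DegreeFinite (linMul α β F) := by
  intro i j
  obtain ⟨n, hn⟩ := h i j
  refine ⟨n, fun k l hkl => ?_⟩
  have h1 := hn (k + 1) l (by lia)
  have h2 := hn k (l + 1) (by lia)
  push_cast at h1 h2
  simp only [linMul_apply, sub_sub, h1, h2, smul_zero, add_zero]

theorem SecondBounded.linMul {F : ℤ → ℤ → M} (h : SecondBounded F) (α β : R) :
    SecondBounded (linMul α β F) := by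
  obtain ⟨J, hJ⟩ := h
  refine ⟨J, fun i j hj => ?_⟩
  rw [linMul_apply, hJ _ _ hj, hJ i (j - 1) (by lia), smul_zero, smul_zero, add_zero]

theorem DegreeFinite.linMul_pow {F : ℤ → ℤ → M} (h : DegreeFinite F) (α β : R) (a : ℕ) :
    DegreeFinite (((_root_.linMul α β) ^ a) F) := by
  induction a with
  | zero => simpa using h
  | succ a ih => rw [pow_succ', Module.End.mul_apply]; exact ih.linMul α β

theorem SecondBounded.linMul_pow {F : ℤ → ℤ → M} (h : SecondBounded F) (α β : R) (a : ℕ) :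
    SecondBounded (((_root_.linMul α β) ^ a) F) := by
  induction a with
  | zero => simpa using h
  | succ a ih => rw [pow_succ', Module.End.mul_apply]; exact ih.linMul α β

/-- The series `∑ₐ cₐ (α x₀ + β x₂)ᵃ F`. -/
noncomputable def powSum (c : ℕ → R) (α β : R) (F : ℤ → ℤ → M) : ℤ → ℤ → M :=
  fun i j => ∑ᶠ a : ℕ, c a • ((linMul α β) ^ a) F i j

theorem DegreeFinite.exists_pow_eq_zero {F : ℤ → ℤ → M} (h : DegreeFinite F) (i j : ℤ) :
    ∃ n, ∀ (α β : R) (a : ℕ), n ≤ a → ((_root_.linMul α β) ^ a) F i j = 0 := by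
  obtain ⟨n, hn⟩ := h i j
  exact ⟨n, fun α β a ha => linMul_pow_eq_zero α β a F i j fun k l hkl => hn k l (by lia)⟩

theorem linMul_powSum (c : ℕ → R) (α β α' β' : R) {F : ℤ → ℤ → M} (h : DegreeFinite F) :
    linMul α' β' (powSum c α β F) = powSum c α β (linMul α' β' F) := by
  funext i j
  obtain ⟨n₁, h₁⟩ := h.exists_pow_eq_zero (R := R) (i - 1) j
  obtain ⟨n₂, h₂⟩ := h.exists_pow_eq_zero (R := R) i (j - 1)
  have hc : ∀ a, ((linMul α β) ^ a) (linMul α' β' F) = linMul α' β' (((linMul α β) ^ a) F) :=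
    fun a => by
      rw [← Module.End.mul_apply, ← Module.End.mul_apply,
        ((linMul_commute α β α' β').pow_left a).eq]
  simp only [linMul_apply, powSum, hc]
  rw [finsum_eq_sum_range (n₁ + n₂) fun a ha => by rw [h₁ α β a (by lia), smul_zero],
    finsum_eq_sum_range (n₁ + n₂) fun a ha => by rw [h₂ α β a (by lia), smul_zero],
    finsum_eq_sum_range (n₁ + n₂) fun a ha => by
      rw [h₁ α β a (by lia), h₂ α β a (by lia), smul_zero, smul_zero, add_zero, smul_zero],
    Finset.smul_sum, Finset.smul_sum, ← Finset.sum_add_distrib]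
  exact Finset.sum_congr rfl fun a _ => by rw [smul_add, smul_comm α', smul_comm β']

theorem linMul_pow_powSum (c : ℕ → R) (α β α' β' : R) (n : ℕ) {F : ℤ → ℤ → M}
    (h : DegreeFinite F) :
    ((linMul α' β') ^ n) (powSum c α β F) = powSum c α β (((linMul α' β') ^ n) F) := by
  induction n with
  | zero => simp
  | succ n ih =>
    rw [pow_succ', Module.End.mul_apply, ih, linMul_powSum c α β α' β' (h.linMul_pow _ _ _),
      Module.End.mul_apply]

/-- The form in which scalars such as φ(x₁ - x₂) and f(x₁ - x₂ - x₀) appear later, as double power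
series. -/
theorem powSum_eq_double (c : ℕ → R) (α β : R) {F : ℤ → ℤ → M} (h : DegreeFinite F) (i j : ℤ) :
    powSum c α β F i j = ∑ᶠ k : ℕ, ∑ᶠ l : ℕ,
      (((k + l).choose k • (α ^ k * β ^ l)) * c (k + l)) • F (i - k) (j - l) := by
  obtain ⟨n, hn⟩ := h i j
  rw [← finsum_antidiagonal n fun k l hkl => by rw [hn k l hkl, smul_zero]]
  refine finsum_congr fun a => ?_
  rw [linMul_pow_apply, Finset.smul_sum]
  refine Finset.sum_congr rfl fun p hp => ?_
  rw [Finset.HasAntidiagonal.mem_antidiagonal] at hp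
  rw [← hp, smul_smul, mul_comm]

/-- The substitution `F(x₀ + x₂, x₂)`, expanded in nonnegative powers of `x₂`. -/
noncomputable def expShift (F : ℤ → ℤ → M) : ℤ → ℤ → M :=
  fun i j => ∑ᶠ p : ℕ, Ring.choose (i + p) p • F (i + p) (j - p)

theorem SecondBounded.expShift_eq {F : ℤ → ℤ → M} {J : ℤ} (hJ : ∀ i j : ℤ, j < J → F i j = 0)
    (i j : ℤ) (n : ℕ) (hn : j - n < J) :
    expShift F i j = ∑ p ∈ Finset.range n, Ring.choose (i + p) p • F (i + p) (j - p) :=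
  finsum_eq_sum_range n fun p hp => by rw [hJ _ _ (by lia), smul_zero]

theorem SecondBounded.expShift {F : ℤ → ℤ → M} (h : SecondBounded F) :
    SecondBounded (expShift F) := by
  obtain ⟨J, hJ⟩ := h
  refine ⟨J, fun i j hj => ?_⟩
  rw [expShift_eq hJ i j 0 (by simpa using hj), Finset.sum_range_zero]

theorem DegreeFinite.expShift {F : ℤ → ℤ → M} (h : DegreeFinite F) (hb : SecondBounded F) :
    DegreeFinite (expShift F) := by
  refine DegreeFinite.of_second hb.expShift fun j => ?_
  obtain ⟨J, hJ⟩ := hb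
  have h0 : ∀ p : ℕ, ∃ n : ℕ, ∀ k : ℕ, n ≤ k → F ((0 : ℤ) - k) (j - p) = 0 := fun p => by
    obtain ⟨n, hn⟩ := h 0 (j - p)
    exact ⟨n, fun k hk => by simpa using hn k 0 (by lia)⟩
  choose n hn using h0
  refine ⟨-((j - J).toNat + 1 + ∑ p ∈ Finset.range ((j - J).toNat + 1), n p : ℕ), fun i hi => ?_⟩
  rw [SecondBounded.expShift_eq hJ i j ((j - J).toNat + 1) (by lia)]
  refine Finset.sum_eq_zero fun p hp => ?_
  have h1 := Finset.single_le_sum (f := n) (fun _ _ => Nat.zero_le _) hp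
  rw [Finset.mem_range] at hp
  have h2 := hn p (-(i + p)).toNat (by lia)
  rw [show (0 : ℤ) - ((-(i + p)).toNat : ℕ) = i + p by lia] at h2
  rw [h2, smul_zero]

theorem expShift_sum {ι : Type*} (s : Finset ι) (F : ι → ℤ → ℤ → M)
    (h : ∀ a ∈ s, SecondBounded (F a)) :
    expShift (∑ a ∈ s, F a) = ∑ a ∈ s, expShift (F a) := by
  funext i j
  simp only [Finset.sum_apply, expShift, Finset.smul_sum]
  refine finsum_sum_comm s _ fun a ha => ?_
  obtain ⟨J, hJ⟩ := h a ha
  refine (Set.finite_Iio ((j - J).toNat + 1)).subset fun p hp => ?_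
  by_contra hn
  simp only [Set.mem_Iio, not_lt] at hn
  exact hp (by simp only; rw [hJ _ _ (by lia), smul_zero])

theorem expShift_add {F G : ℤ → ℤ → M} (hF : SecondBounded F) (hG : SecondBounded G) :
    expShift (F + G) = expShift F + expShift G := by
  simpa using expShift_sum Finset.univ ![F, G] (by simp [Fin.forall_fin_two, hF, hG])

/-- The substitution sends αx₀ + βx₂ to α(x₀ + x₂) + βx₂; on coefficients this is Pascal's rule. -/
theorem expShift_linMul (α β : R) {F : ℤ → ℤ → M} (h : SecondBounded F) :
    expShift (linMul α β F) = linMul α (α + β) (expShift F) := by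
  obtain ⟨J, hJ⟩ := h
  funext i j
  obtain ⟨n, hn⟩ : ∃ n : ℕ, j - n < J := ⟨(j - J).toNat + 1, by lia⟩
  have hJ' : ∀ i j : ℤ, j < J → linMul α β F i j = 0 := fun i j hj => by
    rw [linMul_apply, hJ _ _ hj, hJ i (j - 1) (by lia), smul_zero, smul_zero, add_zero]
  rw [SecondBounded.expShift_eq hJ' i j (n + 1) (by push_cast; lia), linMul_apply,
    SecondBounded.expShift_eq hJ (i - 1) j (n + 1) (by push_cast; lia),
    SecondBounded.expShift_eq hJ i (j - 1) n (by lia), Finset.smul_sum, Finset.smul_sum]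
  have key : ∀ p ∈ Finset.range n,
      Ring.choose (i + (p + 1 : ℕ)) (p + 1) • F (i - 1 + (p + 1 : ℕ)) (j - (p + 1 : ℕ)) =
      Ring.choose (i - 1 + (p + 1 : ℕ)) (p + 1) • F (i - 1 + (p + 1 : ℕ)) (j - (p + 1 : ℕ)) +
      Ring.choose (i + p) p • F (i + p) (j - 1 - p) := fun p _ => by
    have h1 := Ring.choose_succ_succ (i + p) p
    rw [show i - 1 + ((p + 1 : ℕ) : ℤ) = i + p by push_cast; ring,
      show i + ((p + 1 : ℕ) : ℤ) = i + p + 1 by push_cast; ring,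
      show j - ((p + 1 : ℕ) : ℤ) = j - 1 - p by push_cast; ring, h1, add_smul, add_comm]
  simp only [linMul_apply, smul_add, Finset.sum_add_distrib]
  have e1 : ∑ p ∈ Finset.range (n + 1), Ring.choose (i + p) p • α • F (i + p - 1) (j - p) =
      ∑ p ∈ Finset.range (n + 1), α • Ring.choose (i - 1 + p) p • F (i - 1 + p) (j - p) +
      ∑ p ∈ Finset.range n, α • Ring.choose (i + p) p • F (i + p) (j - 1 - p) := by
    rw [Finset.sum_range_succ', Finset.sum_range_succ', add_right_comm, ← Finset.sum_add_distrib]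
    congr 1
    · refine Finset.sum_congr rfl fun p hp => ?_
      rw [← smul_add, ← key p hp, smul_comm,
        show i + ((p + 1 : ℕ) : ℤ) - 1 = i - 1 + (p + 1 : ℕ) by ring]
    · simp
  have e2 : ∑ p ∈ Finset.range (n + 1), Ring.choose (i + p) p • β • F (i + p) (j - p - 1) =
      ∑ p ∈ Finset.range n, β • Ring.choose (i + p) p • F (i + p) (j - 1 - p) := by
    -- The extra summand p = n has exponent j - n - 1 below J, so the ranges n + 1 and n give the
    -- same sum.
    rw [Finset.sum_range_succ, hJ _ (j - (n : ℕ) - 1) (by lia), smul_zero, smul_zero, add_zero]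
    refine Finset.sum_congr rfl fun p _ => ?_
    rw [smul_comm, sub_right_comm]
  rw [e1, e2]
  simp only [add_smul, Finset.sum_add_distrib, add_assoc]

theorem expShift_linMul_pow (α β : R) (a : ℕ) {F : ℤ → ℤ → M} (h : SecondBounded F) :
    expShift (((linMul α β) ^ a) F) = ((linMul α (α + β)) ^ a) (expShift F) := by
  induction a with
  | zero => simp
  | succ a ih =>
    rw [pow_succ', Module.End.mul_apply, expShift_linMul α β (h.linMul_pow _ _ _), ih, pow_succ',
      Module.End.mul_apply]

theorem expShift_powSum (c : ℕ → R) (α β : R) {F : ℤ → ℤ → M} (hb : SecondBounded F)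
    (h : DegreeFinite F) : expShift (powSum c α β F) = powSum c α (α + β) (expShift F) := by
  funext i j
  have hb' := hb
  obtain ⟨J, hJ⟩ := hb
  obtain ⟨n, hn⟩ : ∃ n : ℕ, j - n < J := ⟨(j - J).toNat + 1, by lia⟩
  have hz : ∀ a i j, j < J → ((linMul α β) ^ a) F i j = 0 := fun a i j hj =>
    linMul_pow_eq_zero α β a F i j fun k l _ => hJ _ _ (by lia)
  have h0 : ∀ p : ℕ, ∃ m : ℕ, ∀ a, m ≤ a → ((linMul α β) ^ a) F (i + p) (j - p) = 0 := fun p =>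
    (h.exists_pow_eq_zero (R := R) (i + p) (j - p)).imp fun m hm a ha => hm α β a ha
  choose m hm using h0
  -- Only p < n contribute, so N bounds the relevant exponents a uniformly and the two sums can be
  -- exchanged.
  set N := ∑ p ∈ Finset.range n, m p with hN
  have hN' : ∀ p ∈ Finset.range n, ∀ a, N ≤ a → ((linMul α β) ^ a) F (i + p) (j - p) = 0 :=
    fun p hp a ha => hm p a
      ((Finset.single_le_sum (f := m) (fun _ _ => Nat.zero_le _) hp).trans ha)
  rw [SecondBounded.expShift_eq (J := J) (fun i j hj => by simp [powSum, hz _ i j hj]) i j n hn,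
    powSum]
  simp only [← expShift_linMul_pow α β _ hb', SecondBounded.expShift_eq (hz _) i j n hn]
  rw [finsum_eq_sum_range N fun a ha => by
    rw [Finset.sum_eq_zero fun p hp => by rw [hN' p hp a ha, smul_zero], smul_zero]]
  simp only [Finset.smul_sum]
  rw [Finset.sum_comm]
  refine Finset.sum_congr rfl fun p hp => ?_
  rw [powSum, finsum_eq_sum_range N fun a ha => by rw [hN' p hp a ha, smul_zero], Finset.smul_sum]
  exact Finset.sum_congr rfl fun a _ => smul_comm _ _ _

/-- The substitution is unitriangular in the exponent of x₂: the lowest row is unchanged by it, so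
the rows of F vanish one after another. -/
theorem eq_zero_of_expShift_eq_zero {F : ℤ → ℤ → M} (hb : SecondBounded F)
    (h : expShift F = 0) : F = 0 := by
  obtain ⟨J, hJ⟩ := hb
  have key : ∀ (n : ℕ) (i j : ℤ), j < J + n → F i j = 0 := by
    intro n
    induction n with
    | zero => intro i j hj; exact hJ i j (by simpa using hj)
    | succ n ih =>
      intro i j hj
      have h1 := congrFun (congrFun h i) j
      rw [SecondBounded.expShift_eq (J := J + n) (fun i j hj => ih i j hj) i j 1
        (by push_cast at hj ⊢; lia)] at h1
      simpa using h1
  funext i j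
  exact key (j - J + 1).toNat i j (by lia)

/-- The coefficient of x₀ⁱ x₂ʲ⁺¹ in (x₀ + x₂)F is F(i - 1, j + 1) + F(i, j), so vanishing spreads
upward in i. Some lower bound is needed: x₀ + x₂ annihilates Σ (-1)ⁿ x₀ⁿ x₂⁻ⁿ⁻¹. -/
theorem eq_zero_of_mulAddVars_eq_zero {F : ℤ → ℤ → M} (hb : FirstBounded F)
    (h : mulAddVars F = 0) : F = 0 := by
  obtain ⟨I, hI⟩ := hb
  have key : ∀ (n : ℕ) (i j : ℤ), i < I + n → F i j = 0 := by
    intro n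
    induction n with
    | zero => intro i j hi; exact hI i j (by simpa using hi)
    | succ n ih =>
      intro i j hi
      have h1 := congrFun (congrFun h i) (j + 1)
      simp only [mulAddVars, ih (i - 1) (j + 1) (by push_cast at hi; lia)] at h1
      simpa using h1
  funext i j
  exact key (i - I + 1).toNat i j (by lia)

theorem mulAddVars_swap (F : ℤ → ℤ → M) :
    mulAddVars (fun i j => F j i) = fun i j => mulAddVars F j i := by
  funext i j; simp [mulAddVars, add_comm]

theorem eq_zero_of_mulAddVars_eq_zero' {F : ℤ → ℤ → M} (hb : SecondBounded F)
    (h : mulAddVars F = 0) : F = 0 := by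
  have h1 : (fun i j => F j i) = (0 : ℤ → ℤ → M) :=
    eq_zero_of_mulAddVars_eq_zero (hb.imp fun J hJ i j hj => hJ j i hj)
      (by rw [mulAddVars_swap, h]; rfl)
  funext i j
  exact congrFun (congrFun h1 j) i

theorem mulAddVars_iterate (n : ℕ) (F : ℤ → ℤ → M) :
    mulAddVars^[n] F = ((linMul (1 : R) 1) ^ n) F := by
  rw [Module.End.pow_apply]
  exact congrFun (congrArg (fun f => f^[n]) (funext fun F => (linMul_one_one F).symm)) F

theorem FirstBounded.mulAddVars {F : ℤ → ℤ → M} (h : FirstBounded F) :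
    FirstBounded (mulAddVars F) := by
  obtain ⟨I, hI⟩ := h
  refine ⟨I, fun i j hi => ?_⟩
  rw [_root_.mulAddVars, hI _ _ hi, hI (i - 1) j (by lia), add_zero]

theorem FirstBounded.sub {F G : ℤ → ℤ → M} (hF : FirstBounded F) (hG : FirstBounded G) :
    FirstBounded (F - G) := by
  obtain ⟨I, hI⟩ := hF
  obtain ⟨I', hI'⟩ := hG
  refine ⟨min I I', fun i j hi => ?_⟩
  rw [Pi.sub_apply, Pi.sub_apply, hI i j (by lia), hI' i j (by lia), sub_zero]

theorem SecondBounded.mulAddVars {F : ℤ → ℤ → M} (h : SecondBounded F) :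
    SecondBounded (mulAddVars F) := by
  obtain ⟨I, hI⟩ := h
  refine ⟨I, fun i j hi => ?_⟩
  rw [_root_.mulAddVars, hI _ _ hi, hI i (j - 1) (by lia), add_zero]

theorem eq_zero_of_mulAddVars_iterate {F : ℤ → ℤ → M} (n : ℕ) (hb : FirstBounded F)
    (h : mulAddVars^[n] F = 0) : F = 0 := by
  induction n generalizing F with
  | zero => exact h
  | succ n ih => exact eq_zero_of_mulAddVars_eq_zero hb (ih hb.mulAddVars h)

theorem eq_zero_of_mulAddVars_iterate' {F : ℤ → ℤ → M} (n : ℕ) (hb : SecondBounded F)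
    (h : mulAddVars^[n] F = 0) : F = 0 := by
  induction n generalizing F with
  | zero => exact h
  | succ n ih => exact eq_zero_of_mulAddVars_eq_zero' hb (ih hb.mulAddVars h)

theorem mulAddVars_iterate_eq_of_le {F G : ℤ → ℤ → M} {n m : ℕ} (h : n ≤ m)
    (hFG : mulAddVars^[n] F = mulAddVars^[n] G) : mulAddVars^[m] F = mulAddVars^[m] G := by
  obtain ⟨d, rfl⟩ := Nat.exists_eq_add_of_le' h
  rw [Function.iterate_add_apply, hFG, ← Function.iterate_add_apply]

theorem SecondBounded.powSum {F : ℤ → ℤ → M} (h : SecondBounded F) (c : ℕ → R) (α β : R) :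
    SecondBounded (powSum c α β F) := by
  obtain ⟨J, hJ⟩ := h
  refine ⟨J, fun i j hj => ?_⟩
  have h0 : ∀ a, ((_root_.linMul α β) ^ a) F i j = 0 := fun a =>
    linMul_pow_eq_zero α β a F i j fun k l _ => hJ _ _ (by lia)
  simp [_root_.powSum, h0]

theorem SecondBounded.sum {ι : Type*} (s : Finset ι) (F : ι → ℤ → ℤ → M)
    (h : ∀ a ∈ s, SecondBounded (F a)) : SecondBounded (∑ a ∈ s, F a) := by
  classical
  induction s using Finset.induction_on with
  | empty => exact ⟨0, fun _ _ _ => rfl⟩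
  | insert a s ha ih =>
    rw [Finset.sum_insert ha]
    obtain ⟨J, hJ⟩ := h a (Finset.mem_insert_self a s)
    obtain ⟨J', hJ'⟩ := ih fun b hb => h b (Finset.mem_insert_of_mem hb)
    refine ⟨min J J', fun i j hj => ?_⟩
    rw [Pi.add_apply, Pi.add_apply, hJ i j (by lia), hJ' i j (by lia), add_zero]

end FormalCalculus

/-! ### The differential field of scalar Laurent series -/

section ScalarLaurent

theorem LaurentSeries.coeff_single_mul_hasseDeriv_one (f : LaurentSeries ℂ) (n : ℤ) :
    (HahnSeries.single (1 : ℤ) (1 : ℂ) * LaurentSeries.hasseDeriv ℂ 1 f).coeff n =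
      n • f.coeff n := by
  have h := HahnSeries.coeff_single_mul_add (r := (1 : ℂ)) (x := LaurentSeries.hasseDeriv ℂ 1 f)
    (a := n - 1) (b := (1 : ℤ))
  rw [sub_add_cancel] at h
  rw [h, LaurentSeries.hasseDeriv_coeff, Ring.choose_one_right]
  simp

/-- After multiplication by x the derivative is the Euler operator, which scales the coefficient of
xⁿ by n and does not enlarge supports. The Leibniz rule becomes additivity of exponents over one
common antidiagonal. -/
theorem LaurentSeries.hasseDeriv_one_mul (f g : LaurentSeries ℂ) :
    LaurentSeries.hasseDeriv ℂ 1 (f * g) =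
      LaurentSeries.hasseDeriv ℂ 1 f * g + f * LaurentSeries.hasseDeriv ℂ 1 g := by
  have hx : (HahnSeries.single (1 : ℤ) (1 : ℂ)) ≠ 0 := by simp
  apply mul_left_cancel₀ hx
  rw [mul_add, ← mul_assoc, mul_left_comm _ f]
  set f' := HahnSeries.single (1 : ℤ) (1 : ℂ) * LaurentSeries.hasseDeriv ℂ 1 f with hf
  set g' := HahnSeries.single (1 : ℤ) (1 : ℂ) * LaurentSeries.hasseDeriv ℂ 1 g with hg
  have hf' : ∀ n, f'.coeff n = n • f.coeff n := LaurentSeries.coeff_single_mul_hasseDeriv_one f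
  have hg' : ∀ n, g'.coeff n = n • g.coeff n := LaurentSeries.coeff_single_mul_hasseDeriv_one g
  ext n
  rw [LaurentSeries.coeff_single_mul_hasseDeriv_one, HahnSeries.coeff_add,
    HahnSeries.coeff_mul_left' f.isPWO_support (x := f') (fun m hm => by
      rw [HahnSeries.mem_support, hf'] at hm
      exact fun h => hm (by rw [h, smul_zero])),
    HahnSeries.coeff_mul_right' g.isPWO_support (y := g') (fun m hm => by
      rw [HahnSeries.mem_support, hg'] at hm
      exact fun h => hm (by rw [h, smul_zero])),
    HahnSeries.coeff_mul, ← Finset.sum_add_distrib, Finset.smul_sum]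
  refine Finset.sum_congr rfl fun p hp => ?_
  rw [Finset.mem_antidiagonal] at hp
  rw [hf', hg', ← hp.2.2]
  simp only [zsmul_eq_mul]
  push_cast
  ring

namespace ScalarLaurent

theorem divDeriv_zero : divDeriv 0 = LinearMap.id := LaurentSeries.hasseDeriv_zero

theorem divDeriv_one_mul (f g : ScalarLaurent) :
    divDeriv 1 (f * g) = divDeriv 1 f * g + f * divDeriv 1 g :=
  LaurentSeries.hasseDeriv_one_mul f g

theorem divDeriv_divDeriv (k l : ℕ) (f : ScalarLaurent) :
    divDeriv k (divDeriv l f) = (k + l).choose k • divDeriv (k + l) f :=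
  LaurentSeries.hasseDeriv_comp k l f

/-- The coefficient of `xⁿ`. -/
noncomputable def coeffHom (n : ℤ) : ScalarLaurent →ₗ[ℂ] ℂ where
  toFun f := HahnSeries.coeff (Γ := ℤ) (R := ℂ) f n
  map_add' _ _ := rfl
  map_smul' _ _ := rfl

theorem ext_coeff {f g : ScalarLaurent} (h : ∀ n, coeffHom n f = coeffHom n g) : f = g :=
  HahnSeries.ext (funext h)

theorem coeffHom_algebraMap (c : ℂ) (n : ℤ) :
    coeffHom n (algebraMap ℂ ScalarLaurent c) = if n = 0 then c else 0 := by
  have h : (algebraMap ℂ ScalarLaurent c : LaurentSeries ℂ) = HahnSeries.C c := rfl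
  change HahnSeries.coeff (Γ := ℤ) (R := ℂ) (algebraMap ℂ ScalarLaurent c) n = _
  rw [h, HahnSeries.C_apply, HahnSeries.coeff_single]
  split_ifs <;> rfl

theorem coeffHom_divDeriv (k : ℕ) (f : ScalarLaurent) (n : ℤ) :
    coeffHom n (divDeriv k f) = Ring.choose (n + k) k • coeffHom (n + k) f :=
  LaurentSeries.hasseDeriv_coeff (R := ℂ) k f n

theorem exists_algebraMap_of_divDeriv_one (f : ScalarLaurent) (h : divDeriv 1 f = 0) :
    ∃ c : ℂ, f = algebraMap ℂ ScalarLaurent c := by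
  refine ⟨coeffHom 0 f, ext_coeff fun n => ?_⟩
  rw [coeffHom_algebraMap]
  split_ifs with hn
  · rw [hn]
  · have h1 := coeffHom_divDeriv 1 f (n - 1)
    rw [h, map_zero, Nat.cast_one, sub_add_cancel, Ring.choose_one_right] at h1
    exact (smul_eq_zero.mp h1.symm).resolve_left hn

theorem divDeriv_algebraMap (c : ℂ) (k : ℕ) (hk : k ≠ 0) :
    divDeriv k (algebraMap ℂ ScalarLaurent c) = 0 := by
  refine ext_coeff fun n => ?_
  rw [coeffHom_divDeriv, coeffHom_algebraMap, map_zero]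
  split_ifs with hn
  · rw [hn, show Ring.choose (0 : ℤ) k = 0 by
      rw [Ring.choose_zero_ite, if_neg hk], zero_smul]
  · rw [smul_zero]

theorem divDeriv_one_eq_zero (k : ℕ) (hk : k ≠ 0) : divDeriv k (1 : ScalarLaurent) = 0 := by
  rw [← map_one (algebraMap ℂ ScalarLaurent)]
  exact divDeriv_algebraMap 1 k hk

theorem divDeriv_succ (k : ℕ) (f : ScalarLaurent) :
    (k + 1) • divDeriv (k + 1) f = divDeriv 1 (divDeriv k f) := by
  rw [divDeriv_divDeriv, Nat.choose_one_right, add_comm]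

/-- Induction on k through `divDeriv_succ`; the factor k + 1 cancels in characteristic zero. -/
theorem divDeriv_mul (k : ℕ) (f g : ScalarLaurent) :
    divDeriv k (f * g) =
      ∑ p ∈ Finset.HasAntidiagonal.antidiagonal k, divDeriv p.1 f * divDeriv p.2 g := by
  induction k with
  | zero => simp [divDeriv_zero]
  | succ k ih =>
    have h0 : ((k + 1 : ℕ) : ScalarLaurent) ≠ 0 := by
      rw [← map_natCast (algebraMap ℂ ScalarLaurent)]
      exact (map_ne_zero_iff _ (algebraMap ℂ ScalarLaurent).injective).mpr (by
        exact_mod_cast Nat.succ_ne_zero k)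
    apply mul_left_cancel₀ h0
    rw [← nsmul_eq_mul, divDeriv_succ, ih, map_sum, Finset.mul_sum]
    have h1 : ∀ p ∈ Finset.HasAntidiagonal.antidiagonal (k + 1),
        ((k + 1 : ℕ) : ScalarLaurent) * (divDeriv p.1 f * divDeriv p.2 g) =
          (p.1 • divDeriv p.1 f) * divDeriv p.2 g + divDeriv p.1 f * (p.2 • divDeriv p.2 g) := by
      intro p hp
      rw [Finset.HasAntidiagonal.mem_antidiagonal] at hp
      rw [← hp]
      simp only [nsmul_eq_mul]
      push_cast
      ring
    rw [Finset.sum_congr rfl h1, Finset.sum_add_distrib, Finset.Nat.sum_antidiagonal_succ,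
      Finset.Nat.sum_antidiagonal_succ' (n := k) (f := fun p =>
        divDeriv p.1 f * (p.2 • divDeriv p.2 g))]
    simp only [zero_smul, zero_mul, mul_zero, zero_add, divDeriv_one_mul,
      Finset.sum_add_distrib, divDeriv_succ]

/-- Series that are linearly independent over the constants have nonzero Wronskian. -/
theorem eq_zero_of_sum_divDeriv_mul {n : ℕ} (f g : Fin n → ScalarLaurent)
    (hf : LinearIndependent ℂ f) (h : ∀ k, ∑ i, divDeriv k (f i) * g i = 0) : g = 0 := by
  induction n with
  | zero => exact funext fun i => i.elim0
  | succ n ih =>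
    have hf' : LinearIndependent ℂ (fun i : Fin n => f i.castSucc) :=
      hf.comp _ (Fin.castSucc_injective n)
    have key : g (Fin.last n) = 0 := by
      by_contra hne
      -- Normalising the last coefficient to 1 makes its derivative vanish, so the differentiated
      -- relations have one term fewer.
      set g₁ : Fin (n + 1) → ScalarLaurent := fun i => g i / g (Fin.last n) with hg₁
      have h₁ : ∀ k, ∑ i, divDeriv k (f i) * g₁ i = 0 := fun k => by
        simp only [hg₁, mul_div_assoc', ← Finset.sum_div, h, zero_div]
      have hl : g₁ (Fin.last n) = 1 := div_self hne
      -- Where the derivative falls on f, the result is a multiple of relation k + 1, hence zero;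
      -- the relation for the derivatives of g₁ remains.
      have h₂ : ∀ k, ∑ i, divDeriv k (f i) * divDeriv 1 (g₁ i) = 0 := fun k => by
        have e := congrArg (divDeriv 1) (h₁ k)
        rw [map_sum, map_zero] at e
        simp only [divDeriv_one_mul, Finset.sum_add_distrib, ← divDeriv_succ,
          smul_mul_assoc, ← Finset.smul_sum, h₁, smul_zero, zero_add] at e
        exact e
      have h₃ : (fun i : Fin n => divDeriv 1 (g₁ i.castSucc)) = 0 := ih _ _ hf' fun k => by
        have e := h₂ k
        rw [Fin.sum_univ_castSucc, hl, divDeriv_one_eq_zero 1 one_ne_zero, mul_zero, add_zero] at e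
        exact e
      have h₄ : ∀ i, ∃ c : ℂ, g₁ i = algebraMap ℂ ScalarLaurent c := fun i => by
        induction i using Fin.lastCases with
        | last => exact ⟨1, by rw [hl, map_one]⟩
        | cast i => exact exists_algebraMap_of_divDeriv_one _ (congrFun h₃ i)
      choose c hc using h₄
      have h₅ := h₁ 0
      simp only [divDeriv_zero, LinearMap.id_apply, hc, mul_comm (f _), ← Algebra.smul_def] at h₅
      have h₆ := Fintype.linearIndependent_iff.mp hf c h₅ (Fin.last n)
      rw [hc, h₆, map_zero] at hl
      exact zero_ne_one hl
    have h' := ih (fun i => f i.castSucc) (fun i => g i.castSucc) hf' fun k => by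
      have e := h k
      rwa [Fin.sum_univ_castSucc, key, mul_zero, add_zero] at e
    funext i
    induction i using Fin.lastCases with
    | last => exact key
    | cast i => exact congrFun h' i

/-- Expand t along a basis of the left factor and apply the Wronskian statement to the right
components. -/
theorem eq_zero_of_mul_divDeriv_tensor (t : ScalarLaurent ⊗[ℂ] ScalarLaurent)
    (h : ∀ k, LinearMap.mul' ℂ ScalarLaurent ((divDeriv k).rTensor ScalarLaurent t) = 0) :
    t = 0 := by
  classical
  let e := Module.Basis.ofVectorSpace ℂ ScalarLaurent
  rw [← (TensorProduct.equivFinsuppOfBasisLeft e).symm_apply_apply t] at h ⊢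
  set s := TensorProduct.equivFinsuppOfBasisLeft e t
  rw [TensorProduct.equivFinsuppOfBasisLeft_symm_apply] at h ⊢
  let σ := s.support.equivFin.symm
  have hs : ∀ x : _ → ScalarLaurent ⊗[ℂ] ScalarLaurent,
      ∑ i ∈ s.support, x i = ∑ i, x (σ i : _) := fun x => by
    rw [← Finset.sum_coe_sort, ← Equiv.sum_comp σ]
  rw [Finsupp.sum, hs] at h
  have h0 := eq_zero_of_sum_divDeriv_mul (fun i => e (σ i)) (fun i => s (σ i))
    (e.linearIndependent.comp _ (Subtype.val_injective.comp σ.injective)) fun k => by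
      simpa using h k
  rw [Finsupp.sum, hs]
  refine Finset.sum_eq_zero fun i _ => ?_
  rw [show s (σ i) = 0 from congrFun h0 i, TensorProduct.tmul_zero]

end ScalarLaurent

end ScalarLaurent

/-! ### Jointly injective families and tensor products -/

section JointlyInjective

variable {k ι X E W : Type*} [Field k] [AddCommMonoid X] [AddCommMonoid E] [AddCommMonoid W]
  [Module k X] [Module k E] [Module k W]

/-- A basis of X identifies X ⊗ E with finitely supported families in E, where joint injectivity is
checked componentwise. -/
theorem eq_of_lTensor_eq (φ : ι → E →ₗ[k] W) (hφ : ∀ x y, (∀ i, φ i x = φ i y) → x = y)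
    (t s : X ⊗[k] E) (h : ∀ i, (φ i).lTensor X t = (φ i).lTensor X s) : t = s := by
  classical
  let : AddCommGroup X := Module.addCommMonoidToAddCommGroup k
  let e := Module.Basis.ofVectorSpace k X
  apply (TensorProduct.equivFinsuppOfBasisLeft (N := E) e).injective
  refine Finsupp.ext fun a => hφ _ _ fun i => ?_
  have key : ∀ t : X ⊗[k] E, φ i (TensorProduct.equivFinsuppOfBasisLeft e t a) =
      TensorProduct.equivFinsuppOfBasisLeft e ((φ i).lTensor X t) a := fun t => by
    induction t with
    | zero => simp
    | tmul x y => simp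
    | add x y hx hy => simp only [map_add, Finsupp.add_apply, hx, hy]
  rw [key, key, h]

theorem eq_of_rTensor_eq (φ : ι → E →ₗ[k] W) (hφ : ∀ x y, (∀ i, φ i x = φ i y) → x = y)
    (t s : E ⊗[k] X) (h : ∀ i, (φ i).rTensor X t = (φ i).rTensor X s) : t = s := by
  apply (TensorProduct.comm k E X).injective
  refine eq_of_lTensor_eq φ hφ _ _ fun i => ?_
  rw [← LinearMap.comm_comp_rTensor_comp_comm_eq, LinearMap.comp_apply, LinearMap.comp_apply,
    LinearMap.comp_apply, LinearMap.comp_apply]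
  simp [h i]

end JointlyInjective

/-! ### The operation `Y(m(x₁ - x₂), x₂) m'(x₁)` -/

section ShiftCoeff

variable {V : Type*} [AddCommGroup V] [Module ℂ V]

theorem divDeriv_tmul (k : ℕ) (f : ScalarLaurent) (v : V) :
    divDeriv V k (f ⊗ₜ v) = ScalarLaurent.divDeriv k f ⊗ₜ v := rfl

theorem divDeriv_zero (m : ScalarLaurent ⊗[ℂ] V) : divDeriv V 0 m = m := by
  rw [divDeriv, ScalarLaurent.divDeriv_zero, LinearMap.rTensor_id, LinearMap.id_apply]

theorem divDeriv_one_tmul (k : ℕ) (hk : k ≠ 0) (v : V) :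
    divDeriv V k ((1 : ScalarLaurent) ⊗ₜ[ℂ] v) = 0 := by
  rw [divDeriv_tmul, ScalarLaurent.divDeriv_one_eq_zero k hk, TensorProduct.zero_tmul]

theorem divDeriv_smul (k : ℕ) (f : ScalarLaurent) (m : ScalarLaurent ⊗[ℂ] V) :
    divDeriv V k (f • m) = ∑ p ∈ Finset.HasAntidiagonal.antidiagonal k,
      ScalarLaurent.divDeriv p.1 f • divDeriv V p.2 m := by
  induction m with
  | zero => simp
  | tmul g v =>
    simp only [TensorProduct.smul_tmul', smul_eq_mul, divDeriv_tmul, ScalarLaurent.divDeriv_mul,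
      TensorProduct.sum_tmul]
  | add x y hx hy => simp only [smul_add, map_add, hx, hy, Finset.sum_add_distrib]

theorem divDeriv_divDeriv (k l : ℕ) (m : ScalarLaurent ⊗[ℂ] V) :
    divDeriv V k (divDeriv V l m) = (k + l).choose k • divDeriv V (k + l) m := by
  induction m with
  | zero => simp
  | tmul g v => simp only [divDeriv_tmul, ScalarLaurent.divDeriv_divDeriv, TensorProduct.smul_tmul']
  | add x y hx hy => simp only [smul_add, map_add, hx, hy]

theorem divDeriv_comm (k l : ℕ) (m : ScalarLaurent ⊗[ℂ] V) :
    divDeriv V k (divDeriv V l m) = divDeriv V l (divDeriv V k m) := by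
  rw [divDeriv_divDeriv, divDeriv_divDeriv, Nat.choose_symm_add, add_comm]

namespace NonlocalVertexAlgebra

variable (𝒱 : NonlocalVertexAlgebra V)

theorem coeffK_tmul (j : ℤ) (f g : ScalarLaurent) (u w : V) :
    𝒱.coeffK j (f ⊗ₜ u) (g ⊗ₜ w) = (f * g) ⊗ₜ (𝒱.Y u w).coeff j := rfl

theorem coeffK_smul_smul (j : ℤ) (f g : ScalarLaurent) (m m' : ScalarLaurent ⊗[ℂ] V) :
    𝒱.coeffK j (f • m) (g • m') = (f * g) • 𝒱.coeffK j m m' := by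
  induction m with
  | zero => simp
  | add x y hx hy => simp only [smul_add, map_add, LinearMap.add_apply, hx, hy]
  | tmul f' u =>
    induction m' with
    | zero => simp
    | add x y hx hy => simp only [smul_add, map_add, hx, hy]
    | tmul g' w =>
      simp only [TensorProduct.smul_tmul', coeffK_tmul, smul_eq_mul]
      rw [mul_mul_mul_comm]

theorem divDeriv_one_coeffK (j : ℤ) (m m' : ScalarLaurent ⊗[ℂ] V) :
    divDeriv V 1 (𝒱.coeffK j m m') =
      𝒱.coeffK j (divDeriv V 1 m) m' + 𝒱.coeffK j m (divDeriv V 1 m') := by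
  induction m with
  | zero => simp
  | add x y hx hy =>
    simp only [map_add, LinearMap.add_apply, hx, hy]
    abel
  | tmul f' u =>
    induction m' with
    | zero => simp
    | add x y hx hy =>
      simp only [map_add, hx, hy]
      abel
    | tmul g' w =>
      simp only [coeffK_tmul, divDeriv_tmul, ScalarLaurent.divDeriv_one_mul, TensorProduct.add_tmul]

/-- Derivatives act only on the scalar factor, so the bound is uniform in k. This is what makes the
sum in `shiftCoeff` finite. -/
theorem exists_coeffK_divDeriv_eq_zero (m m' : ScalarLaurent ⊗[ℂ] V) :
    ∃ J : ℤ, ∀ j, j < J → ∀ k, 𝒱.coeffK j (divDeriv V k m) m' = 0 := by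
  induction m with
  | zero => exact ⟨0, by simp⟩
  | add x y hx hy =>
    obtain ⟨J, hJ⟩ := hx
    obtain ⟨J', hJ'⟩ := hy
    refine ⟨min J J', fun j hj k => ?_⟩
    rw [map_add, map_add, LinearMap.add_apply, hJ j (by lia), hJ' j (by lia), add_zero]
  | tmul f' u =>
    induction m' with
    | zero => exact ⟨0, by simp⟩
    | add x y hx hy =>
      obtain ⟨J, hJ⟩ := hx
      obtain ⟨J', hJ'⟩ := hy
      refine ⟨min J J', fun j hj k => ?_⟩
      rw [map_add, hJ j (by lia), hJ' j (by lia), add_zero]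
    | tmul g' w =>
      refine ⟨(𝒱.Y u w).order, fun j hj k => ?_⟩
      rw [divDeriv_tmul, coeffK_tmul, HahnSeries.coeff_eq_zero_of_lt_order hj,
        TensorProduct.tmul_zero]

theorem exists_shiftCoeff_eq_sum (m m' : ScalarLaurent ⊗[ℂ] V) :
    ∃ J : ℤ, ∀ (j : ℤ) (n : ℕ), j - n < J → 𝒱.shiftCoeff m m' j =
      ∑ k ∈ Finset.range n, (-1 : ℂ) ^ k • 𝒱.coeffK (j - k) (divDeriv V k m) m' := by
  obtain ⟨J, hJ⟩ := 𝒱.exists_coeffK_divDeriv_eq_zero m m'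
  exact ⟨J, fun j n hn => finsum_eq_sum_range n fun k hk => by rw [hJ _ (by lia), smul_zero]⟩

/-- The operation `(m, m') ↦ Y(m(x₁ - x₂), x₂) m'(x₁)` as a bilinear map. -/
noncomputable def shiftBilin (j : ℤ) :
    ScalarLaurent ⊗[ℂ] V →ₗ[ℂ] ScalarLaurent ⊗[ℂ] V →ₗ[ℂ] ScalarLaurent ⊗[ℂ] V :=
  LinearMap.mk₂ ℂ (fun m m' => 𝒱.shiftCoeff m m' j)
    (fun m₁ m₂ m' => by
      obtain ⟨J₁, h₁⟩ := 𝒱.exists_shiftCoeff_eq_sum m₁ m'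
      obtain ⟨J₂, h₂⟩ := 𝒱.exists_shiftCoeff_eq_sum m₂ m'
      obtain ⟨J₃, h₃⟩ := 𝒱.exists_shiftCoeff_eq_sum (m₁ + m₂) m'
      -- One truncation n valid for all three sums reduces additivity to that of finite sums.
      obtain ⟨n, hn⟩ : ∃ n : ℕ, j - n < min J₁ (min J₂ J₃) :=
        ⟨(j - min J₁ (min J₂ J₃)).toNat + 1, by lia⟩
      rw [h₁ j n (by lia), h₂ j n (by lia), h₃ j n (by lia), ← Finset.sum_add_distrib]
      simp only [map_add, LinearMap.add_apply, smul_add])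
    (fun c m m' => by
      obtain ⟨J₁, h₁⟩ := 𝒱.exists_shiftCoeff_eq_sum m m'
      obtain ⟨J₂, h₂⟩ := 𝒱.exists_shiftCoeff_eq_sum (c • m) m'
      obtain ⟨n, hn⟩ : ∃ n : ℕ, j - n < min J₁ J₂ := ⟨(j - min J₁ J₂).toNat + 1, by lia⟩
      rw [h₁ j n (by lia), h₂ j n (by lia), Finset.smul_sum]
      simp only [map_smul, LinearMap.smul_apply, smul_comm c])
    (fun m m₁ m₂ => by
      obtain ⟨J₁, h₁⟩ := 𝒱.exists_shiftCoeff_eq_sum m m₁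
      obtain ⟨J₂, h₂⟩ := 𝒱.exists_shiftCoeff_eq_sum m m₂
      obtain ⟨J₃, h₃⟩ := 𝒱.exists_shiftCoeff_eq_sum m (m₁ + m₂)
      obtain ⟨n, hn⟩ : ∃ n : ℕ, j - n < min J₁ (min J₂ J₃) :=
        ⟨(j - min J₁ (min J₂ J₃)).toNat + 1, by lia⟩
      rw [h₁ j n (by lia), h₂ j n (by lia), h₃ j n (by lia), ← Finset.sum_add_distrib]
      simp only [map_add, smul_add])
    (fun c m m' => by
      obtain ⟨J₁, h₁⟩ := 𝒱.exists_shiftCoeff_eq_sum m m'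
      obtain ⟨J₂, h₂⟩ := 𝒱.exists_shiftCoeff_eq_sum m (c • m')
      obtain ⟨n, hn⟩ : ∃ n : ℕ, j - n < min J₁ J₂ := ⟨(j - min J₁ J₂).toNat + 1, by lia⟩
      rw [h₁ j n (by lia), h₂ j n (by lia), Finset.smul_sum]
      simp only [map_smul, smul_comm c])

theorem shiftBilin_apply (j : ℤ) (m m' : ScalarLaurent ⊗[ℂ] V) :
    𝒱.shiftBilin j m m' = 𝒱.shiftCoeff m m' j := rfl

theorem exists_shiftBilin_eq_zero (m m' : ScalarLaurent ⊗[ℂ] V) :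
    ∃ J : ℤ, ∀ j, j < J → 𝒱.shiftBilin j m m' = 0 := by
  obtain ⟨J, hJ⟩ := 𝒱.exists_shiftCoeff_eq_sum m m'
  exact ⟨J, fun j hj => by rw [shiftBilin_apply, hJ j 0 (by simpa using hj), Finset.sum_range_zero]⟩

theorem shiftBilin_one_tmul (j : ℤ) (v : V) (m : ScalarLaurent ⊗[ℂ] V) :
    𝒱.shiftBilin j (1 ⊗ₜ v) m = 𝒱.coeffK j (1 ⊗ₜ v) m := by
  rw [shiftBilin_apply, shiftCoeff, finsum_eq_sum_range 1 fun k hk => by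
    rw [divDeriv_one_tmul k (by lia), map_zero, LinearMap.zero_apply, smul_zero]]
  simp [divDeriv_zero]

theorem shiftBilin_one_tmul_one_tmul (j : ℤ) (v w : V) :
    𝒱.shiftBilin j (1 ⊗ₜ v) (1 ⊗ₜ w) = 1 ⊗ₜ (𝒱.Y v w).coeff j := by
  rw [shiftBilin_one_tmul, coeffK_tmul, mul_one]

theorem shiftBilin_smul_right (j : ℤ) (f : ScalarLaurent) (m m' : ScalarLaurent ⊗[ℂ] V) :
    𝒱.shiftBilin j m (f • m') = f • 𝒱.shiftBilin j m m' := by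
  obtain ⟨J₁, h₁⟩ := 𝒱.exists_shiftCoeff_eq_sum m m'
  obtain ⟨J₂, h₂⟩ := 𝒱.exists_shiftCoeff_eq_sum m (f • m')
  obtain ⟨n, hn⟩ : ∃ n : ℕ, j - n < min J₁ J₂ := ⟨(j - min J₁ J₂).toNat + 1, by lia⟩
  rw [shiftBilin_apply, shiftBilin_apply, h₁ j n (by lia), h₂ j n (by lia), Finset.smul_sum]
  refine Finset.sum_congr rfl fun k _ => ?_
  rw [smul_comm f, ← one_smul ScalarLaurent (divDeriv V k m), coeffK_smul_smul, one_mul,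
    one_smul]

/-- The coefficients of `f(x₁ - x₂)`. -/
noncomputable def _root_.ScalarLaurent.shift (f : ScalarLaurent) (k : ℕ) : ScalarLaurent :=
  (-1 : ℂ) ^ k • ScalarLaurent.divDeriv k f

/-- The first argument is taken at x₁ - x₂, so the scalar comes out as f(x₁ - x₂) and convolves with
the powers of x₂. The proof is the Leibniz rule for divided derivatives, regrouped by total order.
-/
theorem shiftBilin_smul_left (j : ℤ) (f : ScalarLaurent) (m m' : ScalarLaurent ⊗[ℂ] V) :
    𝒱.shiftBilin j (f • m) m' = ∑ᶠ k : ℕ, f.shift k • 𝒱.shiftBilin (j - k) m m' := by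
  obtain ⟨J, hJ⟩ := 𝒱.exists_coeffK_divDeriv_eq_zero m m'
  obtain ⟨n, hn⟩ : ∃ n : ℕ, j - n < J := ⟨(j - J).toNat + 1, by lia⟩
  rw [shiftBilin_apply, shiftCoeff]
  have h1 : ∀ k : ℕ, f.shift k • 𝒱.shiftBilin (j - k) m m' = ∑ᶠ l : ℕ,
      f.shift k • (-1 : ℂ) ^ l • 𝒱.coeffK (j - k - l) (divDeriv V l m) m' := fun k => by
    rw [shiftBilin_apply, shiftCoeff, smul_finsum' (f.shift k)]
    refine (Set.finite_Iio n).subset fun l hl => ?_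
    by_contra hln
    simp only [Set.mem_Iio, not_lt] at hln
    exact hl (by simp only; rw [hJ _ (by lia), smul_zero])
  rw [finsum_congr h1, ← finsum_antidiagonal n fun k l hkl => by
    rw [hJ _ (by lia), smul_zero, smul_zero]]
  refine finsum_congr fun a => ?_
  rw [divDeriv_smul, map_sum, LinearMap.sum_apply, Finset.smul_sum]
  refine Finset.sum_congr rfl fun p hp => ?_
  rw [Finset.HasAntidiagonal.mem_antidiagonal] at hp
  rw [← one_smul ScalarLaurent m', coeffK_smul_smul, one_smul, mul_one, ← hp, ScalarLaurent.shift,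
    smul_assoc, smul_comm (ScalarLaurent.divDeriv p.1 f), smul_smul, ← pow_add, Nat.cast_add,
    sub_sub]

/-- The derivation d/dx₁ commutes with the expansion at x₁ - x₂, so it distributes over the two
arguments. -/
theorem divDeriv_one_shiftBilin (j : ℤ) (m m' : ScalarLaurent ⊗[ℂ] V) :
    divDeriv V 1 (𝒱.shiftBilin j m m') =
      𝒱.shiftBilin j (divDeriv V 1 m) m' + 𝒱.shiftBilin j m (divDeriv V 1 m') := by
  obtain ⟨J₁, h₁⟩ := 𝒱.exists_shiftCoeff_eq_sum m m'
  obtain ⟨J₂, h₂⟩ := 𝒱.exists_shiftCoeff_eq_sum (divDeriv V 1 m) m'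
  obtain ⟨J₃, h₃⟩ := 𝒱.exists_shiftCoeff_eq_sum m (divDeriv V 1 m')
  obtain ⟨n, hn⟩ : ∃ n : ℕ, j - n < min J₁ (min J₂ J₃) :=
    ⟨(j - min J₁ (min J₂ J₃)).toNat + 1, by lia⟩
  rw [shiftBilin_apply, shiftBilin_apply, shiftBilin_apply, h₁ j n (by lia), h₂ j n (by lia),
    h₃ j n (by lia), ← Finset.sum_add_distrib, map_sum]
  refine Finset.sum_congr rfl fun k _ => ?_
  rw [map_smul, divDeriv_one_coeffK, smul_add, divDeriv_comm]

/-- Since Y(v, x₂)𝟏 has no negative powers, only k = 0 contributes to x₂⁰. -/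
theorem shiftBilin_vac_right (m : ScalarLaurent ⊗[ℂ] V) :
    𝒱.shiftBilin 0 m (1 ⊗ₜ 𝒱.vac) = m := by
  have h : ∀ (n : ScalarLaurent ⊗[ℂ] V) (j : ℤ), 𝒱.coeffK j n (1 ⊗ₜ 𝒱.vac) =
      if j < 0 then 0 else 𝒱.coeffK j n (1 ⊗ₜ 𝒱.vac) := fun n j => by
    split_ifs with hj
    · induction n with
      | zero => simp
      | tmul f v => rw [coeffK_tmul, 𝒱.creation_nonneg v j hj, TensorProduct.tmul_zero]
      | add x y hx hy => rw [map_add, LinearMap.add_apply, hx, hy, add_zero]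
    · rfl
  rw [shiftBilin_apply, shiftCoeff, finsum_eq_sum_range 1 fun k hk => by
    rw [h, if_pos (by lia), smul_zero]]
  simp only [Finset.sum_range_one, pow_zero, one_smul, divDeriv_zero, Nat.cast_zero, sub_zero]
  induction m with
  | zero => simp
  | tmul f v => rw [coeffK_tmul, 𝒱.creation_zero, mul_one]
  | add x y hx hy => rw [map_add, LinearMap.add_apply, hx, hy]

theorem shiftBilin_vac_left (m : ScalarLaurent ⊗[ℂ] V) :
    𝒱.shiftBilin 0 (1 ⊗ₜ 𝒱.vac) m = m := by
  rw [shiftBilin_one_tmul]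
  induction m with
  | zero => simp
  | tmul f v => rw [coeffK_tmul, 𝒱.vac_left, one_mul, HahnSeries.coeff_single_same]
  | add x y hx hy => rw [map_add, hx, hy]

end NonlocalVertexAlgebra

end ShiftCoeff

/-! ### Consequences of nondegeneracy -/

section Nondegenerate

/-- The power series in two variables with coefficients `g`, as an iterated Laurent series. -/
noncomputable def natSeries (g : ℕ → ℕ → ℂ) : iterLaurent ℂ 2 :=
  ⟨fun q => if 0 ≤ q 0 ∧ 0 ≤ q 1 then g (q 0).toNat (q 1).toNat else 0, by
    refine ⟨⟨0, fun p k hk => ?_⟩, fun k => ⟨⟨0, fun p l hl => ?_⟩, fun _ => trivial⟩⟩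
    · have : (Fin.snoc p k : Fin 2 → ℤ) 1 = k := Fin.snoc_last (α := fun _ => ℤ) k p
      simp only
      rw [if_neg (by rw [this]; lia)]
    · have h1 : (Fin.snoc (Fin.snoc p l : Fin 1 → ℤ) k : Fin 2 → ℤ) 0 = l := rfl
      simp only
      rw [if_neg (by rw [h1]; lia)]⟩

theorem natSeries_apply (g : ℕ → ℕ → ℂ) (k l : ℕ) : (natSeries g).1 ![(k : ℤ), (l : ℤ)] = g k l := by
  simp [natSeries]

theorem iterLaurentMul_natSeries {M : Type*} [AddCommGroup M] [Module ℂ M] (g : ℕ → ℕ → ℂ)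
    (F : iterLaurent M 2) (m : Fin 2 → ℤ) (n : ℕ)
    (hn : ∀ k l : ℕ, n ≤ k + l → F.1 ![m 0 - k, m 1 - l] = 0) :
    iterLaurentMul M 2 (natSeries g) F m =
      ∑ᶠ k : ℕ, ∑ᶠ l : ℕ, g k l • F.1 ![m 0 - k, m 1 - l] := by
  classical
  have h1 : ∀ k : ℕ, ∑ᶠ l : ℕ, g k l • F.1 ![m 0 - k, m 1 - l] =
      ∑ l ∈ Finset.range n, g k l • F.1 ![m 0 - k, m 1 - l] := fun k =>
    finsum_eq_sum_range n fun l hl => by rw [hn k l (by lia), smul_zero]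
  rw [finsum_congr h1, finsum_eq_sum_range n fun k hk => Finset.sum_eq_zero fun l _ => by
    rw [hn k l (by lia), smul_zero], ← Finset.sum_product']
  have hm : ∀ a b : ℤ, m - ![a, b] = ![m 0 - a, m 1 - b] := fun a b => by
    funext i; fin_cases i <;> rfl
  have hinj : Set.InjOn (fun x : ℕ × ℕ => (![(x.1 : ℤ), (x.2 : ℤ)] : Fin 2 → ℤ))
      (Finset.range n ×ˢ Finset.range n : Finset (ℕ × ℕ)) := by
    rintro ⟨a, b⟩ _ ⟨c, d⟩ _ h
    have h0 := congrFun h 0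
    have h1 := congrFun h 1
    simp only [Matrix.cons_val_zero, Matrix.cons_val_one, Nat.cast_inj] at h0 h1
    rw [h0, h1]
  change ∑ᶠ p : Fin 2 → ℤ, (natSeries g).1 p • F.1 (m - p) = _
  rw [finsum_eq_sum_of_support_subset (s := (Finset.range n ×ˢ Finset.range n).image
      (fun x : ℕ × ℕ => (![(x.1 : ℤ), (x.2 : ℤ)] : Fin 2 → ℤ))), Finset.sum_image hinj]
  · exact Finset.sum_congr rfl fun x _ => by rw [natSeries_apply, hm]
  · intro p hp
    have hp1 : 0 ≤ p 0 ∧ 0 ≤ p 1 := by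
      by_contra hneg
      exact hp (by simp only [natSeries, if_neg hneg, zero_smul])
    have hpe : p = ![((p 0).toNat : ℤ), ((p 1).toNat : ℤ)] := by
      funext i
      fin_cases i
      · simp [hp1.1]
      · simp [hp1.2]
    have hlt : (p 0).toNat + (p 1).toNat < n := by
      by_contra hneg
      refine hp ?_
      simp only
      rw [hpe, hm, hn _ _ (not_lt.mp hneg), smul_zero]
    simp only [Finset.coe_image, Set.mem_image, Finset.mem_coe, Finset.mem_product,
      Finset.mem_range]
    exact ⟨((p 0).toNat, (p 1).toNat), ⟨by lia, by lia⟩, hpe.symm⟩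

namespace NonlocalVertexAlgebra

variable {V : Type*} [AddCommGroup V] [Module ℂ V] (𝒱 : NonlocalVertexAlgebra V)

/-- The coefficients of `Y(u, x₁) Y(v, x₂) w`. -/
def nestedProduct (u v w : V) : ℤ → ℤ → V := fun i j => (𝒱.Y u ((𝒱.Y v w).coeff j)).coeff i

theorem shiftedProduct_eq (u v w : V) :
    shiftedProduct 𝒱.Y u v w = expShift (𝒱.nestedProduct u v w) := rfl

theorem nestedProduct_secondBounded (u v w : V) : SecondBounded (𝒱.nestedProduct u v w) :=
  ⟨(𝒱.Y v w).order, fun i j hj => by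
    rw [nestedProduct, HahnSeries.coeff_eq_zero_of_lt_order hj, map_zero, HahnSeries.coeff_zero]⟩

theorem nestedProduct_degreeFinite (u v w : V) : DegreeFinite (𝒱.nestedProduct u v w) :=
  .of_second (𝒱.nestedProduct_secondBounded u v w) fun j =>
    ⟨(𝒱.Y u ((𝒱.Y v w).coeff j)).order, fun _ hi => HahnSeries.coeff_eq_zero_of_lt_order hi⟩

theorem iteratedProduct_firstBounded (u v w : V) : FirstBounded (iteratedProduct 𝒱.Y u v w) :=
  ⟨(𝒱.Y u v).order, fun i j hi => by
    rw [iteratedProduct, HahnSeries.coeff_eq_zero_of_lt_order hi, map_zero, LinearMap.zero_apply,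
      HahnSeries.coeff_zero]⟩

theorem iteratedProduct_degreeFinite (u v w : V) : DegreeFinite (iteratedProduct 𝒱.Y u v w) :=
  .of_first (𝒱.iteratedProduct_firstBounded u v w) fun i =>
    ⟨(𝒱.Y ((𝒱.Y u v).coeff i) w).order, fun _ hj => HahnSeries.coeff_eq_zero_of_lt_order hj⟩

variable {ι : Type*} (e : Module.Basis ι ℂ V)

/-- Expanded in ℂ[[x₁, x₂]], φ(x₁ - x₂) is an admissible scalar for Z₂, so the relation says that Z₂
kills one explicit tensor. -/
theorem eq_zero_of_sum_nestedProduct (h𝒱 : 𝒱.Nondegenerate) (s : Finset (ι × ι))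
    (φ : ι × ι → ℕ → ℂ)
    (h : ∑ p ∈ s, powSum (φ p) 1 (-1) (𝒱.nestedProduct (e p.1) (e p.2) 𝒱.vac) = 0) :
    ∀ p ∈ s, φ p = 0 := by
  classical
  set g : ι × ι → ℕ → ℕ → ℂ := fun p k l =>
    ((k + l).choose k • ((1 : ℂ) ^ k * (-1) ^ l)) * φ p (k + l) with hg
  set z : (⨂[ℂ] _ : Fin 2, V) ⊗[ℂ] iterLaurent ℂ 2 :=
    ∑ p ∈ s, (PiTensorProduct.tprod ℂ ![e p.1, e p.2]) ⊗ₜ natSeries (g p) with hz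
  have hz0 : z = 0 := by
    apply h𝒱 2 two_pos
    rw [map_zero, hz, map_sum]
    funext m
    have h' := congrFun (congrFun h (m 0)) (m 1)
    simp only [Finset.sum_apply, Pi.zero_apply] at h'
    rw [Pi.zero_apply, ← h', Finset.sum_apply]
    refine Finset.sum_congr rfl fun p _ => ?_
    obtain ⟨n, hn⟩ := 𝒱.nestedProduct_degreeFinite (e p.1) (e p.2) 𝒱.vac (m 0) (m 1)
    rw [powSum_eq_double _ _ _ (𝒱.nestedProduct_degreeFinite _ _ _)]
    simp only [Z, TensorProduct.lift.tmul, PiTensorProduct.lift.tprod,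
      LinearMap.compMultilinearMap_apply, LinearMap.flip_apply]
    rw [iterLaurentMul_natSeries (g p) _ m n fun k l hkl => hn k l hkl]
    rfl
  intro p hp
  have hF : natSeries (g p) = 0 := by
    -- Coordinate functionals on the two factors V isolate the series attached to p.
    have h1 := congrArg ((TensorProduct.lid ℂ (iterLaurent ℂ 2)).toLinearMap ∘ₗ
      (PiTensorProduct.lift ((MultilinearMap.mkPiAlgebra ℂ (Fin 2) ℂ).compLinearMap
        fun i => e.coord (![p.1, p.2] i))).rTensor (iterLaurent ℂ 2)) hz0
    rw [map_zero, hz, map_sum, Finset.sum_eq_single p] at h1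
    · simpa using h1
    · intro q _ hqp
      have : q.1 ≠ p.1 ∨ q.2 ≠ p.2 := by
        by_contra hcon
        push Not at hcon
        exact hqp (Prod.ext hcon.1 hcon.2)
      rcases this with h2 | h2
      · simp [Finsupp.single_eq_of_ne' h2]
      · simp [Finsupp.single_eq_of_ne' h2]
    · exact fun hn => absurd hp hn
  funext n
  -- At x₂⁰ the series φ(x₁ - x₂) has the coefficients of φ.
  have h2 := natSeries_apply (g p) n 0
  rw [hF] at h2
  simpa [hg] using h2.symm

/-- Apply Y(·, x₂)𝟏 to the relation, pass to Y(u, x₀ + x₂) Y(v, x₂)𝟏 by weak associativity, and undo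
the substitution x₁ = x₀ + x₂. -/
theorem eq_zero_of_sum_Y (h𝒱 : 𝒱.Nondegenerate) (s : Finset (ι × ι)) (φ : ι × ι → ℕ → ℂ)
    (h : ∀ j : ℤ, ∑ p ∈ s, ∑ᶠ k : ℕ, φ p k • (𝒱.Y (e p.1) (e p.2)).coeff (j - k) = 0) :
    ∀ p ∈ s, φ p = 0 := by
  have hfin : ∀ (p : ι × ι) (j : ℤ), ∃ n : ℕ, ∀ k : ℕ, n ≤ k →
      (𝒱.Y (e p.1) (e p.2)).coeff (j - k) = 0 := fun p j =>
    ⟨(j - (𝒱.Y (e p.1) (e p.2)).order).toNat + 1, fun k hk =>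
      HahnSeries.coeff_eq_zero_of_lt_order (by lia)⟩
  refine 𝒱.eq_zero_of_sum_nestedProduct e h𝒱 s φ ?_
  have hit : ∑ p ∈ s, powSum (φ p) 1 0 (iteratedProduct 𝒱.Y (e p.1) (e p.2) 𝒱.vac) = 0 := by
    funext i j
    let Λ : V →ₗ[ℂ] V :=
      { toFun := fun x => (𝒱.Y x 𝒱.vac).coeff j
        map_add' := fun _ _ => by simp
        map_smul' := fun _ _ => by simp }
    have h1 := congrArg Λ (h i)
    rw [map_zero, map_sum] at h1
    simp only [Finset.sum_apply]
    rw [Pi.zero_apply, Pi.zero_apply, ← h1]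
    refine Finset.sum_congr rfl fun p _ => ?_
    obtain ⟨n, hn⟩ := hfin p i
    rw [powSum, finsum_eq_sum_range n fun k hk => by
        rw [linMul_one_zero_pow, iteratedProduct, hn k hk, map_zero, LinearMap.zero_apply,
          HahnSeries.coeff_zero, smul_zero],
      finsum_eq_sum_range n fun k hk => by rw [hn k hk, smul_zero], map_sum]
    exact Finset.sum_congr rfl fun k _ => by rw [linMul_one_zero_pow, map_smul]; rfl
  choose l hl using fun p : ι × ι => 𝒱.weak_assoc (e p.1) (e p.2) 𝒱.vac
  -- The sum of the exponents l p serves all p ∈ s at once.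
  have hL : ∀ p ∈ s, ((linMul (1 : ℂ) 1) ^ (∑ p ∈ s, l p))
      (expShift (𝒱.nestedProduct (e p.1) (e p.2) 𝒱.vac)) =
      ((linMul (1 : ℂ) 1) ^ (∑ p ∈ s, l p)) (iteratedProduct 𝒱.Y (e p.1) (e p.2) 𝒱.vac) :=
    fun p hp => by
      rw [← mulAddVars_iterate, ← mulAddVars_iterate]
      exact mulAddVars_iterate_eq_of_le
        (Finset.single_le_sum (f := l) (fun _ _ => Nat.zero_le _) hp) (hl p)
  have hb := fun p : ι × ι => 𝒱.nestedProduct_secondBounded (e p.1) (e p.2) 𝒱.vac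
  have hd := fun p : ι × ι => 𝒱.nestedProduct_degreeFinite (e p.1) (e p.2) 𝒱.vac
  have hsh : ∑ p ∈ s, powSum (φ p) 1 0 (expShift (𝒱.nestedProduct (e p.1) (e p.2) 𝒱.vac)) = 0 := by
    -- The substituted nested products are bounded below in x₂, so the power of x₀ + x₂ cancels on
    -- that side.
    refine eq_zero_of_mulAddVars_iterate' (∑ p ∈ s, l p)
      (.sum s _ fun p _ => (hb p).expShift.powSum _ _ _) ?_
    rw [mulAddVars_iterate (R := ℂ), map_sum, ← map_zero ((linMul (1 : ℂ) 1) ^ (∑ p ∈ s, l p)),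
      ← hit, map_sum]
    refine Finset.sum_congr rfl fun p hp => ?_
    rw [linMul_pow_powSum _ _ _ _ _ _ ((hd p).expShift (hb p)), hL p hp,
      linMul_pow_powSum _ _ _ _ _ _ (𝒱.iteratedProduct_degreeFinite _ _ _)]
  refine eq_zero_of_expShift_eq_zero (.sum s _ fun p _ => (hb p).powSum _ _ _) ?_
  rw [expShift_sum s _ fun p _ => (hb p).powSum _ _ _, ← hsh]
  -- Under x₁ = x₀ + x₂ the form x₁ - x₂ becomes x₀.
  exact Finset.sum_congr rfl fun p _ => by
    rw [expShift_powSum _ _ _ (hb p) (hd p), add_neg_cancel]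

/-- The operation `(m, m') ↦ Y(m(x₁ - x₂), x₂) m'(x₁)` on the tensor square. -/
noncomputable def shiftTensor (j : ℤ) :
    (ScalarLaurent ⊗[ℂ] V) ⊗[ℂ] (ScalarLaurent ⊗[ℂ] V) →ₗ[ℂ] ScalarLaurent ⊗[ℂ] V :=
  TensorProduct.lift (𝒱.shiftBilin j)

theorem shiftTensor_tmul (j : ℤ) (m m' : ScalarLaurent ⊗[ℂ] V) :
    𝒱.shiftTensor j (m ⊗ₜ m') = 𝒱.shiftBilin j m m' := TensorProduct.lift.tmul _ _

/-- The coefficient of x₁ⁿ is a power series in x₂ times Y(u, x₂)w, the shape required by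
`eq_zero_of_sum_Y`. -/
theorem coeff_shiftTensor (n j : ℤ) (τ : ScalarLaurent ⊗[ℂ] ScalarLaurent) (u w : V) :
    (ScalarLaurent.coeffHom n).rTensor V (𝒱.shiftTensor j
      ((TensorProduct.tensorTensorTensorComm ℂ ScalarLaurent ScalarLaurent V V) (τ ⊗ₜ (u ⊗ₜ w)))) =
    1 ⊗ₜ ∑ᶠ k : ℕ, ((-1 : ℂ) ^ k * ScalarLaurent.coeffHom n (LinearMap.mul' ℂ ScalarLaurent
      ((ScalarLaurent.divDeriv k).rTensor ScalarLaurent τ))) • (𝒱.Y u w).coeff (j - k) := by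
  have h0 : ∀ k : ℕ, (j - (𝒱.Y u w).order).toNat + 1 ≤ k → (𝒱.Y u w).coeff (j - k) = 0 :=
    fun k hk => HahnSeries.coeff_eq_zero_of_lt_order (by lia)
  rw [finsum_eq_sum_range _ fun k hk => by rw [h0 k hk, smul_zero], TensorProduct.tmul_sum]
  induction τ with
  | zero => simp
  | add x y hx hy =>
    simp only [TensorProduct.add_tmul, map_add, hx, hy, mul_add, add_smul, TensorProduct.tmul_add,
      Finset.sum_add_distrib]
  | tmul f g =>
    rw [TensorProduct.tensorTensorTensorComm_tmul, shiftTensor_tmul, shiftBilin_apply, shiftCoeff,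
      finsum_eq_sum_range _ fun k hk => by
        rw [divDeriv_tmul, coeffK_tmul, h0 k hk, TensorProduct.tmul_zero, smul_zero], map_sum]
    refine Finset.sum_congr rfl fun k _ => ?_
    rw [divDeriv_tmul, coeffK_tmul, map_smul, LinearMap.rTensor_tmul, LinearMap.rTensor_tmul,
      LinearMap.mul'_apply, TensorProduct.smul_tmul', ← TensorProduct.smul_tmul]
    simp

/-- Gather the scalars into ℂ((x)) ⊗ ℂ((x)) and expand V ⊗ V in a basis. Independence over ℂ[[x₂]]
kills every coefficient in x₁ of every Σ f⁽ᵏ⁾ g, and the Wronskian argument kills the scalar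
tensors. -/
theorem eq_zero_of_shiftTensor_eq_zero (h𝒱 : 𝒱.Nondegenerate)
    (t : (ScalarLaurent ⊗[ℂ] V) ⊗[ℂ] (ScalarLaurent ⊗[ℂ] V))
    (h : ∀ j, 𝒱.shiftTensor j t = 0) : t = 0 := by
  classical
  let e := Module.Basis.ofVectorSpace ℂ V
  let T := TensorProduct.tensorTensorTensorComm ℂ ScalarLaurent ScalarLaurent V V
  let Q := TensorProduct.equivFinsuppOfBasisRight (M := ScalarLaurent ⊗[ℂ] ScalarLaurent)
    (e.tensorProduct e)
  obtain ⟨s, rfl⟩ : ∃ s, t = T (Q.symm s) := ⟨Q (T.symm t), by simp⟩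
  suffices hs : s = 0 by rw [hs, map_zero, map_zero]
  have hQ : Q.symm s = ∑ p ∈ s.support, s p ⊗ₜ (e p.1 ⊗ₜ e p.2) := by
    rw [TensorProduct.equivFinsuppOfBasisRight_symm_apply, Finsupp.sum]
    exact Finset.sum_congr rfl fun p _ => by rw [Module.Basis.tensorProduct_apply']
  have key : ∀ (n : ℤ), ∀ p ∈ s.support, (fun k : ℕ => ((-1 : ℂ) ^ k * ScalarLaurent.coeffHom n
      (LinearMap.mul' ℂ ScalarLaurent
        ((ScalarLaurent.divDeriv k).rTensor ScalarLaurent (s p))))) = 0 := fun n => by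
    refine 𝒱.eq_zero_of_sum_Y e h𝒱 s.support (fun p k => ((-1 : ℂ) ^ k * ScalarLaurent.coeffHom n
      (LinearMap.mul' ℂ ScalarLaurent
        ((ScalarLaurent.divDeriv k).rTensor ScalarLaurent (s p))))) fun j => ?_
    have h1 := congrArg ((ScalarLaurent.coeffHom n).rTensor V) (h j)
    rw [hQ, map_sum, map_sum, map_sum, map_zero, Finset.sum_congr rfl fun p _ =>
      𝒱.coeff_shiftTensor n j (s p) (e p.1) (e p.2), ← TensorProduct.tmul_sum] at h1
    simpa using congrArg (TensorProduct.lid ℂ V) h1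
  refine Finsupp.ext fun p => ?_
  by_cases hp : p ∈ s.support
  · refine ScalarLaurent.eq_zero_of_mul_divDeriv_tensor _ fun k => ?_
    refine ScalarLaurent.ext_coeff fun n => ?_
    have h1 := congrFun (key n p hp) k
    simp only [Pi.zero_apply, mul_eq_zero, pow_eq_zero_iff', neg_eq_zero, one_ne_zero, false_and,
      false_or] at h1
    rw [h1, map_zero]
  · simpa using hp

theorem eq_of_shiftTensor_eq (h𝒱 : 𝒱.Nondegenerate)
    {t s : (ScalarLaurent ⊗[ℂ] V) ⊗[ℂ] (ScalarLaurent ⊗[ℂ] V)}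
    (h : ∀ j, 𝒱.shiftTensor j t = 𝒱.shiftTensor j s) : t = s :=
  sub_eq_zero.mp (𝒱.eq_zero_of_shiftTensor_eq_zero h𝒱 _ fun j => by rw [map_sub, h, sub_self])

end NonlocalVertexAlgebra

end Nondegenerate

/-! ### Weak associativity over the Laurent series -/

section WeakAssociativity

theorem expShift_map {M M' : Type*} [AddCommGroup M] [AddCommGroup M'] [Module ℂ M] [Module ℂ M']
    (L : M →ₗ[ℂ] M') {F : ℤ → ℤ → M} (h : SecondBounded F) :
    expShift (fun i j => L (F i j)) = fun i j => L (expShift F i j) := by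
  funext i j
  obtain ⟨J, hJ⟩ := h
  obtain ⟨n, hn⟩ : ∃ n : ℕ, j - n < J := ⟨(j - J).toNat + 1, by lia⟩
  rw [SecondBounded.expShift_eq hJ i j n hn, SecondBounded.expShift_eq (F := fun i j => L (F i j))
    (fun i j hj => by simp only [hJ i j hj, map_zero]) i j n hn, map_sum]
  exact Finset.sum_congr rfl fun p _ => (map_zsmul L _ _).symm

theorem mulAddVars_iterate_map {M M' : Type*} [AddCommGroup M] [AddCommGroup M'] [Module ℂ M]
    [Module ℂ M'] (L : M →ₗ[ℂ] M') (n : ℕ) (F : ℤ → ℤ → M) :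
    mulAddVars^[n] (fun i j => L (F i j)) = fun i j => L (mulAddVars^[n] F i j) := by
  induction n generalizing F with
  | zero => rfl
  | succ n ih =>
    rw [Function.iterate_succ_apply, Function.iterate_succ_apply, ← ih]
    congr 1
    funext i j
    simp only [mulAddVars, map_add]

theorem ScalarLaurent.shift_shift (f : ScalarLaurent) (k l : ℕ) :
    (f.shift k).shift l = (k + l).choose k • f.shift (k + l) := by
  rw [ScalarLaurent.shift, ScalarLaurent.shift, ScalarLaurent.shift, map_smul,
    ScalarLaurent.divDeriv_divDeriv, smul_smul, ← pow_add, add_comm l k, Nat.choose_symm_add,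
    smul_comm]

namespace NonlocalVertexAlgebra

variable {V : Type*} [AddCommGroup V] [Module ℂ V] (𝒱 : NonlocalVertexAlgebra V)
variable (m₁ m₂ m₃ : ScalarLaurent ⊗[ℂ] V)

/-- The coefficients of `Y(Y(m₁(x₁ - x₂ - x₀), x₀) m₂(x₁ - x₂), x₂) m₃(x₁)`. -/
noncomputable def iterShift : ℤ → ℤ → ScalarLaurent ⊗[ℂ] V :=
  fun i j => 𝒱.shiftBilin j (𝒱.shiftBilin i m₁ m₂) m₃

/-- The coefficients of `Y(m₁(x₁ - x₂), x₂) Y(m₂(x₁ - x₃), x₃) m₃(x₁)`. -/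
noncomputable def nestShift : ℤ → ℤ → ScalarLaurent ⊗[ℂ] V :=
  fun i j => 𝒱.shiftBilin i m₁ (𝒱.shiftBilin j m₂ m₃)

theorem iterShift_firstBounded : FirstBounded (𝒱.iterShift m₁ m₂ m₃) := by
  obtain ⟨I, hI⟩ := 𝒱.exists_shiftBilin_eq_zero m₁ m₂
  exact ⟨I, fun i j hi => by rw [iterShift, hI i hi, map_zero, LinearMap.zero_apply]⟩

theorem iterShift_degreeFinite : DegreeFinite (𝒱.iterShift m₁ m₂ m₃) :=
  .of_first (𝒱.iterShift_firstBounded m₁ m₂ m₃) fun _ => 𝒱.exists_shiftBilin_eq_zero _ _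

theorem nestShift_secondBounded : SecondBounded (𝒱.nestShift m₁ m₂ m₃) := by
  obtain ⟨I, hI⟩ := 𝒱.exists_shiftBilin_eq_zero m₂ m₃
  exact ⟨I, fun i j hj => by rw [nestShift, hI j hj, map_zero]⟩

theorem nestShift_degreeFinite : DegreeFinite (𝒱.nestShift m₁ m₂ m₃) :=
  .of_second (𝒱.nestShift_secondBounded m₁ m₂ m₃) fun _ => 𝒱.exists_shiftBilin_eq_zero _ _

theorem shiftBilin_smul_left_support (j : ℤ) (f : ScalarLaurent) :
    (Function.support fun k : ℕ => f.shift k • 𝒱.shiftBilin (j - k) m₁ m₂).Finite := by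
  obtain ⟨J, hJ⟩ := 𝒱.exists_shiftBilin_eq_zero m₁ m₂
  refine (Set.finite_Iio ((j - J).toNat + 1)).subset fun k hk => ?_
  by_contra hn
  simp only [Set.mem_Iio, not_lt] at hn
  exact hk (by simp only; rw [hJ _ (by lia), smul_zero])

/-- The scalar is taken at x₁ - x₂ - x₀, whence the form x₀ + x₂. In `nestShift_smul_first` the form
is the first variable alone, which `expShift` turns into x₀ + x₂. -/
theorem iterShift_smul_first (f : ScalarLaurent) :
    𝒱.iterShift (f • m₁) m₂ m₃ = powSum f.shift 1 1 (𝒱.iterShift m₁ m₂ m₃) := by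
  funext i j
  rw [powSum_eq_double _ _ _ (𝒱.iterShift_degreeFinite m₁ m₂ m₃), iterShift, shiftBilin_smul_left,
    ← LinearMap.flip_apply, ← LinearMap.toAddMonoidHom_coe,
    AddMonoidHom.map_finsum _ (𝒱.shiftBilin_smul_left_support m₁ m₂ i f)]
  refine finsum_congr fun k => ?_
  rw [LinearMap.toAddMonoidHom_coe, LinearMap.flip_apply, shiftBilin_smul_left]
  refine finsum_congr fun l => ?_
  rw [ScalarLaurent.shift_shift, one_pow, one_pow, mul_one, smul_mul_assoc, one_mul]
  rfl

theorem nestShift_smul_first (f : ScalarLaurent) :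
    𝒱.nestShift (f • m₁) m₂ m₃ = powSum f.shift 1 0 (𝒱.nestShift m₁ m₂ m₃) := by
  funext i j
  rw [nestShift, shiftBilin_smul_left]
  exact finsum_congr fun k => by rw [linMul_one_zero_pow]; rfl

theorem iterShift_smul_second (f : ScalarLaurent) :
    𝒱.iterShift m₁ (f • m₂) m₃ = powSum f.shift 0 1 (𝒱.iterShift m₁ m₂ m₃) := by
  funext i j
  rw [iterShift, shiftBilin_smul_right, shiftBilin_smul_left]
  exact finsum_congr fun k => by rw [linMul_zero_one_pow]; rfl

theorem nestShift_smul_second (f : ScalarLaurent) :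
    𝒱.nestShift m₁ (f • m₂) m₃ = powSum f.shift 0 1 (𝒱.nestShift m₁ m₂ m₃) := by
  funext i j
  rw [nestShift, shiftBilin_smul_left, ← LinearMap.toAddMonoidHom_coe,
    AddMonoidHom.map_finsum _ (𝒱.shiftBilin_smul_left_support m₂ m₃ j f)]
  exact finsum_congr fun k => by
    rw [linMul_zero_one_pow, LinearMap.toAddMonoidHom_coe, shiftBilin_smul_right]; rfl

theorem iterShift_smul_third (f : ScalarLaurent) :
    𝒱.iterShift m₁ m₂ (f • m₃) =
      fun i j => Algebra.lsmul ℂ ℂ (ScalarLaurent ⊗[ℂ] V) f (𝒱.iterShift m₁ m₂ m₃ i j) := by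
  funext i j
  rw [iterShift, shiftBilin_smul_right]
  rfl

theorem nestShift_smul_third (f : ScalarLaurent) :
    𝒱.nestShift m₁ m₂ (f • m₃) =
      fun i j => Algebra.lsmul ℂ ℂ (ScalarLaurent ⊗[ℂ] V) f (𝒱.nestShift m₁ m₂ m₃ i j) := by
  funext i j
  rw [nestShift, shiftBilin_smul_right, shiftBilin_smul_right]
  rfl

/-- By additivity pure tensors suffice, and for constant ones this is weak associativity in V. Each
scalar factor then acts on the two sides by operators that match under `expShift` and commute with
x₀ + x₂, so l does not change. -/
theorem weak_assoc_shift : ∃ l : ℕ, mulAddVars^[l] (expShift (𝒱.nestShift m₁ m₂ m₃)) =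
    mulAddVars^[l] (𝒱.iterShift m₁ m₂ m₃) := by
  have hadd : ∀ {A A' B B' : ℤ → ℤ → ScalarLaurent ⊗[ℂ] V}
      (_ : ∃ l : ℕ, mulAddVars^[l] A = mulAddVars^[l] A')
      (_ : ∃ l : ℕ, mulAddVars^[l] B = mulAddVars^[l] B'),
      ∃ l : ℕ, mulAddVars^[l] (A + B) = mulAddVars^[l] (A' + B') := by
    rintro A A' B B' ⟨l, hl⟩ ⟨l', hl'⟩
    refine ⟨max l l', ?_⟩
    have h1 := mulAddVars_iterate_eq_of_le (le_max_left l l') hl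
    have h2 := mulAddVars_iterate_eq_of_le (le_max_right l l') hl'
    rw [mulAddVars_iterate (R := ℂ), mulAddVars_iterate (R := ℂ)] at h1 h2 ⊢
    rw [map_add, map_add, h1, h2]
  have hzero : ∀ {A A' : ℤ → ℤ → ScalarLaurent ⊗[ℂ] V}, A = 0 → A' = 0 →
      ∃ l : ℕ, mulAddVars^[l] (expShift A) = mulAddVars^[l] A' := fun hA hA' =>
    ⟨0, by subst hA hA'; funext i j; simp [expShift]⟩
  induction m₁ with
  | zero => exact hzero (by funext i j; simp [nestShift]) (by funext i j; simp [iterShift])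
  | add x y hx hy =>
    have h1 : 𝒱.nestShift (x + y) m₂ m₃ = 𝒱.nestShift x m₂ m₃ + 𝒱.nestShift y m₂ m₃ := by
      funext i j; simp [nestShift]
    have h2 : 𝒱.iterShift (x + y) m₂ m₃ = 𝒱.iterShift x m₂ m₃ + 𝒱.iterShift y m₂ m₃ := by
      funext i j; simp [iterShift]
    rw [h1, h2, expShift_add (𝒱.nestShift_secondBounded _ _ _) (𝒱.nestShift_secondBounded _ _ _)]
    exact hadd hx hy
  | tmul f₁ u =>
  induction m₂ with
  | zero => exact hzero (by funext i j; simp [nestShift]) (by funext i j; simp [iterShift])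
  | add x y hx hy =>
    have h1 : 𝒱.nestShift (f₁ ⊗ₜ u) (x + y) m₃ =
        𝒱.nestShift (f₁ ⊗ₜ u) x m₃ + 𝒱.nestShift (f₁ ⊗ₜ u) y m₃ := by
      funext i j; simp [nestShift]
    have h2 : 𝒱.iterShift (f₁ ⊗ₜ u) (x + y) m₃ =
        𝒱.iterShift (f₁ ⊗ₜ u) x m₃ + 𝒱.iterShift (f₁ ⊗ₜ u) y m₃ := by
      funext i j; simp [iterShift]
    rw [h1, h2, expShift_add (𝒱.nestShift_secondBounded _ _ _) (𝒱.nestShift_secondBounded _ _ _)]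
    exact hadd hx hy
  | tmul f₂ v =>
  induction m₃ with
  | zero => exact hzero (by funext i j; simp [nestShift]) (by funext i j; simp [iterShift])
  | add x y hx hy =>
    have h1 : 𝒱.nestShift (f₁ ⊗ₜ u) (f₂ ⊗ₜ v) (x + y) =
        𝒱.nestShift (f₁ ⊗ₜ u) (f₂ ⊗ₜ v) x + 𝒱.nestShift (f₁ ⊗ₜ u) (f₂ ⊗ₜ v) y := by
      funext i j; simp [nestShift]
    have h2 : 𝒱.iterShift (f₁ ⊗ₜ u) (f₂ ⊗ₜ v) (x + y) =
        𝒱.iterShift (f₁ ⊗ₜ u) (f₂ ⊗ₜ v) x + 𝒱.iterShift (f₁ ⊗ₜ u) (f₂ ⊗ₜ v) y := by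
      funext i j; simp [iterShift]
    rw [h1, h2, expShift_add (𝒱.nestShift_secondBounded _ _ _) (𝒱.nestShift_secondBounded _ _ _)]
    exact hadd hx hy
  | tmul f₃ w =>
  obtain ⟨l, hl⟩ := 𝒱.weak_assoc u v w
  refine ⟨l, ?_⟩
  have ht : ∀ (f : ScalarLaurent) (v : V), f ⊗ₜ[ℂ] v = f • (1 ⊗ₜ[ℂ] v) := fun f v => by
    rw [TensorProduct.smul_tmul', smul_eq_mul, mul_one]
  have hb := 𝒱.nestShift_secondBounded
  have hd := 𝒱.nestShift_degreeFinite
  have hi := 𝒱.iterShift_degreeFinite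
  let L : V →ₗ[ℂ] ScalarLaurent ⊗[ℂ] V := TensorProduct.mk ℂ ScalarLaurent V 1
  have e0 : mulAddVars^[l] (expShift (𝒱.nestShift (1 ⊗ₜ u) (1 ⊗ₜ v) (1 ⊗ₜ w))) =
      mulAddVars^[l] (𝒱.iterShift (1 ⊗ₜ u) (1 ⊗ₜ v) (1 ⊗ₜ w)) := by
    have h1 : 𝒱.nestShift (1 ⊗ₜ u) (1 ⊗ₜ v) (1 ⊗ₜ w) =
        fun i j => L (𝒱.nestedProduct u v w i j) := by
      funext i j
      simp only [nestShift, shiftBilin_one_tmul_one_tmul]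
      rfl
    have h2 : 𝒱.iterShift (1 ⊗ₜ u) (1 ⊗ₜ v) (1 ⊗ₜ w) =
        fun i j => L (iteratedProduct 𝒱.Y u v w i j) := by
      funext i j
      simp only [iterShift, shiftBilin_one_tmul_one_tmul]
      rfl
    rw [h1, h2, expShift_map L (𝒱.nestedProduct_secondBounded u v w), mulAddVars_iterate_map,
      mulAddVars_iterate_map, ← shiftedProduct_eq, hl]
  have e1 : mulAddVars^[l] (expShift (𝒱.nestShift (1 ⊗ₜ u) (1 ⊗ₜ v) (f₃ ⊗ₜ w))) =
      mulAddVars^[l] (𝒱.iterShift (1 ⊗ₜ u) (1 ⊗ₜ v) (f₃ ⊗ₜ w)) := by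
    rw [ht f₃, nestShift_smul_third, iterShift_smul_third, expShift_map _ (hb _ _ _),
      mulAddVars_iterate_map, mulAddVars_iterate_map, e0]
  have e2 : mulAddVars^[l] (expShift (𝒱.nestShift (1 ⊗ₜ u) (f₂ ⊗ₜ v) (f₃ ⊗ₜ w))) =
      mulAddVars^[l] (𝒱.iterShift (1 ⊗ₜ u) (f₂ ⊗ₜ v) (f₃ ⊗ₜ w)) := by
    rw [mulAddVars_iterate (R := ScalarLaurent), mulAddVars_iterate (R := ScalarLaurent)] at e1 ⊢
    rw [ht f₂, nestShift_smul_second, iterShift_smul_second, expShift_powSum _ _ _ (hb _ _ _)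
      (hd _ _ _), zero_add, linMul_pow_powSum _ _ _ _ _ _ ((hd _ _ _).expShift (hb _ _ _)), e1,
      linMul_pow_powSum _ _ _ _ _ _ (hi _ _ _)]
  rw [mulAddVars_iterate (R := ScalarLaurent), mulAddVars_iterate (R := ScalarLaurent)] at e2 ⊢
  rw [ht f₁, nestShift_smul_first, iterShift_smul_first, expShift_powSum _ _ _ (hb _ _ _)
    (hd _ _ _), add_zero, linMul_pow_powSum _ _ _ _ _ _ ((hd _ _ _).expShift (hb _ _ _)), e2,
    linMul_pow_powSum _ _ _ _ _ _ (hi _ _ _)]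

end NonlocalVertexAlgebra

end WeakAssociativity

/-! ### Coproducts as tensors and the space `B(V)` -/

section Coproduct

variable {V : Type*} [AddCommGroup V] [Module ℂ V]

namespace LaurentHom

/-- Evaluation at a vector. -/
noncomputable def eval (m : ScalarLaurent ⊗[ℂ] V) : LaurentHom V →ₗ[ℂ] ScalarLaurent ⊗[ℂ] V where
  toFun a := a m
  map_add' _ _ := rfl
  map_smul' _ _ := rfl

theorem ext_one_tmul {a b : LaurentHom V} (h : ∀ v : V, a (1 ⊗ₜ v) = b (1 ⊗ₜ v)) : a = b := by
  refine LinearMap.ext fun m => ?_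
  induction m with
  | zero => simp
  | add x y hx hy => rw [map_add, map_add, hx, hy]
  | tmul f v =>
    rw [show f ⊗ₜ[ℂ] v = f • ((1 : ScalarLaurent) ⊗ₜ[ℂ] v) by
      rw [TensorProduct.smul_tmul', smul_eq_mul, mul_one], map_smul, map_smul, h]

/-- Seen as a commutator with d/dx, the derivative is visibly a derivation for composition. The two
agree because a is ℂ((x))-linear and f ⊗ v = f • (1 ⊗ v). -/
theorem ddx_apply (a : LaurentHom V) (m : ScalarLaurent ⊗[ℂ] V) :
    ddx a m = divDeriv V 1 (a m) - a (divDeriv V 1 m) := by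
  induction m with
  | zero => simp
  | add x y hx hy => simp only [map_add, hx, hy]; abel
  | tmul f v =>
    have h1 : ∀ f : ScalarLaurent, f ⊗ₜ[ℂ] v = f • ((1 : ScalarLaurent) ⊗ₜ[ℂ] v) := fun f => by
      rw [TensorProduct.smul_tmul', smul_eq_mul, mul_one]
    have h2 : ddx a (f ⊗ₜ v) = f • divDeriv V 1 (a (1 ⊗ₜ v)) :=
      LinearMap.liftBaseChange_tmul (M := V) (N := ScalarLaurent ⊗[ℂ] V) ScalarLaurent
        (divDeriv V 1 ∘ₗ a.restrictScalars ℂ ∘ₗ TensorProduct.mk ℂ ScalarLaurent V 1) f v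
    rw [h2, divDeriv_tmul, h1 f, h1 (ScalarLaurent.divDeriv 1 f), LinearMap.map_smul a,
      LinearMap.map_smul a, divDeriv_smul,
      Finset.Nat.sum_antidiagonal_succ, Finset.Nat.antidiagonal_zero, Finset.sum_singleton]
    simp only [ScalarLaurent.divDeriv_zero, LinearMap.id_apply, zero_add, divDeriv_zero]
    abel

/-- The derivation `d/dx` as a linear map. -/
noncomputable def ddxLinear : LaurentHom V →ₗ[ℂ] LaurentHom V where
  toFun := ddx
  map_add' a b := LinearMap.ext fun m => by
    simp only [ddx_apply, LinearMap.add_apply, map_add]; abel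
  map_smul' c a := LinearMap.ext fun m => by
    simp only [ddx_apply, LinearMap.smul_apply, map_smul, RingHom.id_apply, smul_sub]

theorem ddxLinear_apply (a : LaurentHom V) : ddxLinear a = ddx a := rfl

theorem ddx_mul (a b : LaurentHom V) : ddx (a * b) = ddx a * b + a * ddx b :=
  LinearMap.ext fun m => by
    simp only [ddx_apply, LinearMap.add_apply, Module.End.mul_apply, map_sub]; abel

end LaurentHom

open LaurentHom

namespace NonlocalVertexAlgebra

variable (𝒱 : NonlocalVertexAlgebra V)

/-- `∑ b ⊗ c ↦ ∑ Y(b(x₁ - x₂) m, x₂) c(x₁) m'`. -/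
noncomputable def coEval (m m' : ScalarLaurent ⊗[ℂ] V) (j : ℤ) :
    LaurentHom V ⊗[ℂ] LaurentHom V →ₗ[ℂ] ScalarLaurent ⊗[ℂ] V :=
  𝒱.shiftTensor j ∘ₗ TensorProduct.map (eval m) (eval m')

theorem coEval_tmul (m m' : ScalarLaurent ⊗[ℂ] V) (j : ℤ) (b c : LaurentHom V) :
    𝒱.coEval m m' j (b ⊗ₜ c) = 𝒱.shiftBilin j (b m) (c m') := rfl

/-- Evaluations at 1 ⊗ v separate the points of A, hence of each tensor factor over a field, and
nondegeneracy separates the resulting tensors. A general A allows tensors over B(V) itself. -/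
theorem eq_of_coEval_eq (h𝒱 : 𝒱.Nondegenerate) {A : Type*} [AddCommMonoid A] [Module ℂ A]
    {ρ : A →ₗ[ℂ] LaurentHom V} (hρ : Function.Injective ρ) {t s : A ⊗[ℂ] A}
    (h : ∀ (v w : V) (j : ℤ), 𝒱.coEval (1 ⊗ₜ v) (1 ⊗ₜ w) j (TensorProduct.map ρ ρ t) =
      𝒱.coEval (1 ⊗ₜ v) (1 ⊗ₜ w) j (TensorProduct.map ρ ρ s)) : t = s := by
  have hinj : ∀ x y : A, (∀ v : V, (eval (1 ⊗ₜ v) ∘ₗ ρ) x = (eval (1 ⊗ₜ v) ∘ₗ ρ) y) → x = y :=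
    fun x y hxy => hρ (ext_one_tmul hxy)
  refine eq_of_lTensor_eq _ hinj t s fun w => ?_
  refine eq_of_rTensor_eq _ hinj _ _ fun v => ?_
  rw [← LinearMap.comp_apply, ← LinearMap.comp_apply, LinearMap.rTensor_comp_lTensor]
  refine 𝒱.eq_of_shiftTensor_eq h𝒱 fun j => ?_
  rw [TensorProduct.map_comp]
  exact h v w j

/-- The relation `a(x₁) Y(v, x₂) = ∑ᵢ Y(bᵢ(x₁ - x₂) v, x₂) cᵢ(x₁)` for `t = ∑ᵢ bᵢ ⊗ cᵢ`. -/
def IsCoproductTensor (a : LaurentHom V) (t : LaurentHom V ⊗[ℂ] LaurentHom V) : Prop :=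
  ∀ (v w : V) (j : ℤ), a (1 ⊗ₜ (𝒱.Y v w).coeff j) = 𝒱.coEval (1 ⊗ₜ v) (1 ⊗ₜ w) j t

variable {𝒱}

theorem isCoproduct_iff (a : LaurentHom V) {r : ℕ} (b c : Fin r → LaurentHom V) :
    𝒱.IsCoproduct a b c ↔ 𝒱.IsCoproductTensor a (∑ i, b i ⊗ₜ c i) := by
  simp only [IsCoproduct, IsCoproductTensor, map_sum, coEval_tmul, shiftBilin_apply]

theorem IsCoproductTensor.unique (h𝒱 : 𝒱.Nondegenerate) {A : Type*} [AddCommMonoid A]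
    [Module ℂ A] {ρ : A →ₗ[ℂ] LaurentHom V} (hρ : Function.Injective ρ) {a : LaurentHom V}
    {t t' : A ⊗[ℂ] A} (h : 𝒱.IsCoproductTensor a (TensorProduct.map ρ ρ t))
    (h' : 𝒱.IsCoproductTensor a (TensorProduct.map ρ ρ t')) : t = t' :=
  𝒱.eq_of_coEval_eq h𝒱 hρ fun v w j => (h v w j).symm.trans (h' v w j)

theorem IsCoproductTensor.add {a b : LaurentHom V} {t s : LaurentHom V ⊗[ℂ] LaurentHom V}
    (ha : 𝒱.IsCoproductTensor a t) (hb : 𝒱.IsCoproductTensor b s) :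
    𝒱.IsCoproductTensor (a + b) (t + s) := fun v w j => by
  rw [map_add, ← ha, ← hb, LinearMap.add_apply]

theorem IsCoproductTensor.smul (c : ℂ) {a : LaurentHom V} {t : LaurentHom V ⊗[ℂ] LaurentHom V}
    (ha : 𝒱.IsCoproductTensor a t) : 𝒱.IsCoproductTensor (c • a) (c • t) := fun v w j => by
  rw [map_smul, ← ha, LinearMap.smul_apply]

theorem IsCoproductTensor.zero : 𝒱.IsCoproductTensor 0 0 := fun v w j => by
  rw [map_zero, LinearMap.zero_apply]

theorem IsCoproductTensor.one : 𝒱.IsCoproductTensor 1 (1 ⊗ₜ 1) := fun v w j => by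
  rw [coEval_tmul, Module.End.one_apply, Module.End.one_apply, Module.End.one_apply,
    shiftBilin_one_tmul_one_tmul]

/-- The lower bound is carried through the induction because splitting the infinite sum requires
finite supports. -/
theorem coEval_smul_left (f : ScalarLaurent) (m m' : ScalarLaurent ⊗[ℂ] V) (j : ℤ)
    (t : LaurentHom V ⊗[ℂ] LaurentHom V) :
    𝒱.coEval (f • m) m' j t = ∑ᶠ k : ℕ, f.shift k • 𝒱.coEval m m' (j - k) t ∧
      ∃ J : ℤ, ∀ j, j < J → 𝒱.coEval m m' j t = 0 := by
  induction t with
  | zero => simp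
  | tmul b c =>
    refine ⟨?_, 𝒱.exists_shiftBilin_eq_zero (b m) (c m')⟩
    rw [coEval_tmul, map_smul, shiftBilin_smul_left]
    rfl
  | add x y hx hy =>
    obtain ⟨hx, J, hJ⟩ := hx
    obtain ⟨hy, J', hJ'⟩ := hy
    refine ⟨?_, min J J', fun j hj => by rw [map_add, hJ j (by lia), hJ' j (by lia), add_zero]⟩
    rw [map_add, hx, hy, ← finsum_add_distrib]
    · exact finsum_congr fun k => by rw [map_add, smul_add]
    · refine (Set.finite_Iio ((j - J).toNat + 1)).subset fun k hk => ?_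
      by_contra hn
      simp only [Set.mem_Iio, not_lt] at hn
      exact hk (by simp only; rw [hJ _ (by lia), smul_zero])
    · refine (Set.finite_Iio ((j - J').toNat + 1)).subset fun k hk => ?_
      by_contra hn
      simp only [Set.mem_Iio, not_lt] at hn
      exact hk (by simp only; rw [hJ' _ (by lia), smul_zero])

theorem coEval_smul_right (f : ScalarLaurent) (m m' : ScalarLaurent ⊗[ℂ] V) (j : ℤ)
    (t : LaurentHom V ⊗[ℂ] LaurentHom V) :
    𝒱.coEval m (f • m') j t = f • 𝒱.coEval m m' j t := by
  induction t with
  | zero => simp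
  | tmul b c => rw [coEval_tmul, coEval_tmul, map_smul, shiftBilin_smul_right]
  | add x y hx hy => rw [map_add, map_add, hx, hy, smul_add]

variable (𝒱) in
theorem coEval_zero_left (m' : ScalarLaurent ⊗[ℂ] V) (j : ℤ) : 𝒱.coEval 0 m' j = 0 := by
  rw [coEval, show eval (0 : ScalarLaurent ⊗[ℂ] V) = 0 from LinearMap.ext fun a => map_zero a,
    TensorProduct.map_zero_left, LinearMap.comp_zero]

variable (𝒱) in
theorem coEval_zero_right (m : ScalarLaurent ⊗[ℂ] V) (j : ℤ) : 𝒱.coEval m 0 j = 0 := by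
  rw [coEval, show eval (0 : ScalarLaurent ⊗[ℂ] V) = 0 from LinearMap.ext fun a => map_zero a,
    TensorProduct.map_zero_right, LinearMap.comp_zero]

theorem _root_.LaurentHom.eval_add (m n : ScalarLaurent ⊗[ℂ] V) :
    eval (m + n) = eval m + eval n := LinearMap.ext fun a => map_add a m n

variable (𝒱) in
theorem coEval_add_left (m n m' : ScalarLaurent ⊗[ℂ] V) (j : ℤ) :
    𝒱.coEval (m + n) m' j = 𝒱.coEval m m' j + 𝒱.coEval n m' j := by
  rw [coEval, eval_add, TensorProduct.map_add_left, LinearMap.comp_add]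
  rfl

variable (𝒱) in
theorem coEval_add_right (m m' n' : ScalarLaurent ⊗[ℂ] V) (j : ℤ) :
    𝒱.coEval m (m' + n') j = 𝒱.coEval m m' j + 𝒱.coEval m n' j := by
  rw [coEval, eval_add, TensorProduct.map_add_right, LinearMap.comp_add]
  rfl

/-- Composing operators needs the relation on V ⊗ ℂ((x)), not only on V. It extends because both
sides scale by f(x₁ - x₂) in the first argument and by g(x₁) in the second. -/
theorem IsCoproductTensor.apply_shiftBilin {a : LaurentHom V}
    {t : LaurentHom V ⊗[ℂ] LaurentHom V} (h : 𝒱.IsCoproductTensor a t)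
    (m m' : ScalarLaurent ⊗[ℂ] V) (j : ℤ) : a (𝒱.shiftBilin j m m') = 𝒱.coEval m m' j t := by
  have ht : ∀ (f : ScalarLaurent) (v : V), f ⊗ₜ[ℂ] v = f • (1 ⊗ₜ[ℂ] v) := fun f v => by
    rw [TensorProduct.smul_tmul', smul_eq_mul, mul_one]
  induction m with
  | zero => rw [map_zero, LinearMap.zero_apply, map_zero, coEval_zero_left, LinearMap.zero_apply]
  | add x y hx hy =>
    rw [map_add, LinearMap.add_apply, map_add, hx, hy, coEval_add_left, LinearMap.add_apply]
  | tmul f u =>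
    induction m' with
    | zero => rw [map_zero, map_zero, coEval_zero_right, LinearMap.zero_apply]
    | add x y hx hy => rw [map_add, map_add, hx, hy, coEval_add_right, LinearMap.add_apply]
    | tmul g w =>
      rw [ht f, ht g, shiftBilin_smul_right, LinearMap.map_smul a, coEval_smul_right,
        shiftBilin_smul_left, (coEval_smul_left f _ _ j t).1, ← LinearMap.toAddMonoidHom_coe,
        AddMonoidHom.map_finsum _ (𝒱.shiftBilin_smul_left_support _ _ j f)]
      congr 1
      refine finsum_congr fun k => ?_
      rw [LinearMap.toAddMonoidHom_coe, LinearMap.map_smul a, shiftBilin_one_tmul_one_tmul, h]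

theorem coEval_mul_tmul (t : LaurentHom V ⊗[ℂ] LaurentHom V) (b c : LaurentHom V)
    (m m' : ScalarLaurent ⊗[ℂ] V) (j : ℤ) :
    𝒱.coEval m m' j (t * b ⊗ₜ c) = 𝒱.coEval (b m) (c m') j t := by
  induction t with
  | zero => rw [zero_mul, map_zero, map_zero]
  | tmul b' c' => rw [Algebra.TensorProduct.tmul_mul_tmul]; rfl
  | add x y hx hy => rw [add_mul, map_add, map_add, hx, hy]

theorem IsCoproductTensor.mul {a b : LaurentHom V} {t s : LaurentHom V ⊗[ℂ] LaurentHom V}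
    (ha : 𝒱.IsCoproductTensor a t) (hb : 𝒱.IsCoproductTensor b s) :
    𝒱.IsCoproductTensor (a * b) (t * s) := fun v w j => by
  rw [Module.End.mul_apply, hb]
  clear hb
  induction s with
  | zero => rw [mul_zero, map_zero, map_zero]
  | tmul b' c' => rw [coEval_mul_tmul, coEval_tmul, ha.apply_shiftBilin]
  | add x y hx hy => rw [mul_add, map_add, map_add, map_add, hx, hy]

/-- Differentiate the relation in x₁; constant tensors have zero derivative, so the derivative falls
on b and c only. -/
theorem IsCoproductTensor.ddx {a : LaurentHom V} {t : LaurentHom V ⊗[ℂ] LaurentHom V}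
    (h : 𝒱.IsCoproductTensor a t) : 𝒱.IsCoproductTensor (LaurentHom.ddx a)
      (ddxLinear.rTensor _ t + ddxLinear.lTensor _ t) := fun v w j => by
  rw [ddx_apply, h, divDeriv_one_tmul 1 one_ne_zero, map_zero, sub_zero]
  clear h
  induction t with
  | zero => simp only [map_zero, add_zero]
  | tmul b c =>
    rw [map_add, LinearMap.rTensor_tmul, LinearMap.lTensor_tmul, coEval_tmul, coEval_tmul,
      coEval_tmul, divDeriv_one_shiftBilin, ddxLinear_apply, ddxLinear_apply, ddx_apply, ddx_apply,
      divDeriv_one_tmul 1 one_ne_zero, divDeriv_one_tmul 1 one_ne_zero, map_zero, map_zero,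
      sub_zero, sub_zero]
  | add x y hx hy =>
    simp only [map_add] at hx hy ⊢
    rw [hx, hy]
    abel

/-! ### B(V) as the greatest solution of U ≤ `coproductSubmodule U` -/

variable (𝒱)

/-- The elements that preserve the vacuum line and have a coproduct in `U ⊗ U`. -/
noncomputable def coproductSubmodule (U : Submodule ℂ (LaurentHom V)) :
    Submodule ℂ (LaurentHom V) where
  carrier := {a | (∃ t : U ⊗[ℂ] U, 𝒱.IsCoproductTensor a (TensorProduct.map U.subtype U.subtype t)) ∧
    ∃ c : ℂ, a (1 ⊗ₜ 𝒱.vac) = c • ((1 : ScalarLaurent) ⊗ₜ[ℂ] 𝒱.vac)}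
  zero_mem' := ⟨⟨0, by rw [map_zero]; exact .zero⟩, 0, by rw [LinearMap.zero_apply, zero_smul]⟩
  add_mem' := by
    rintro a b ⟨⟨t, ht⟩, c, hc⟩ ⟨⟨s, hs⟩, d, hd⟩
    exact ⟨⟨t + s, by rw [map_add]; exact ht.add hs⟩, c + d, by
      rw [LinearMap.add_apply, hc, hd, add_smul]⟩
  smul_mem' := by
    rintro x a ⟨⟨t, ht⟩, c, hc⟩
    exact ⟨⟨x • t, by rw [map_smul]; exact ht.smul x⟩, x * c, by
      rw [LinearMap.smul_apply, hc, mul_smul]⟩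

theorem coproductSubmodule_mono {U U' : Submodule ℂ (LaurentHom V)} (h : U ≤ U') :
    𝒱.coproductSubmodule U ≤ 𝒱.coproductSubmodule U' := by
  rintro a ⟨⟨t, ht⟩, hc⟩
  refine ⟨⟨TensorProduct.map (Submodule.inclusion h) (Submodule.inclusion h) t, ?_⟩, hc⟩
  rw [← LinearMap.comp_apply, ← TensorProduct.map_comp]
  exact ht

theorem le_coproductSubmodule_iff (U : Submodule ℂ (LaurentHom V)) :
    U ≤ 𝒱.coproductSubmodule U ↔ 𝒱.DeltaClosed (U : Set (LaurentHom V)) ∧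
      ∀ a ∈ U, ∃ c : ℂ, a (1 ⊗ₜ 𝒱.vac) = c • ((1 : ScalarLaurent) ⊗ₜ[ℂ] 𝒱.vac) := by
  constructor
  · refine fun h => ⟨fun a ha => ?_, fun a ha => (h ha).2⟩
    obtain ⟨t, ht⟩ := (h ha).1
    obtain ⟨r, b, c, rfl⟩ := TensorProduct.exists_sum_tmul_eq t
    refine ⟨r, fun i => b i, fun i => c i, fun i => (b i).2, fun i => (c i).2, ?_⟩
    rw [isCoproduct_iff]
    simpa only [map_sum, TensorProduct.map_tmul, Submodule.subtype_apply] using ht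
  · rintro ⟨h, hc⟩ a ha
    refine ⟨?_, hc a ha⟩
    obtain ⟨r, b, c, hb, hc, h⟩ := h a ha
    refine ⟨∑ i, ⟨b i, hb i⟩ ⊗ₜ ⟨c i, hc i⟩, ?_⟩
    rw [isCoproduct_iff] at h
    simpa only [map_sum, TensorProduct.map_tmul, Submodule.subtype_apply] using h

theorem le_B {U : Submodule ℂ (LaurentHom V)} (h : U ≤ 𝒱.coproductSubmodule U) : U ≤ 𝒱.B :=
  le_sSup ((𝒱.le_coproductSubmodule_iff U).mp h)

/-- By monotonicity the sum of the admissible subspaces is again admissible. -/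
theorem B_le : 𝒱.B ≤ 𝒱.coproductSubmodule 𝒱.B :=
  sSup_le fun U hU => ((𝒱.le_coproductSubmodule_iff U).mpr hU).trans
    (𝒱.coproductSubmodule_mono (le_sSup hU))

theorem one_mem_B : (1 : LaurentHom V) ∈ 𝒱.B := by
  refine 𝒱.le_B (U := Submodule.span ℂ {1}) ?_ (Submodule.mem_span_singleton_self 1)
  rw [Submodule.span_singleton_le_iff_mem]
  exact ⟨⟨⟨1, Submodule.mem_span_singleton_self 1⟩ ⊗ₜ ⟨1, Submodule.mem_span_singleton_self 1⟩,
    IsCoproductTensor.one⟩, 1, by rw [Module.End.one_apply, one_smul]⟩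

theorem mul_mem_B {a b : LaurentHom V} (ha : a ∈ 𝒱.B) (hb : b ∈ 𝒱.B) : a * b ∈ 𝒱.B := by
  -- The product of two coproducts lies in (B · B) ⊗ (B · B), so B · B is admissible.
  refine 𝒱.le_B (U := 𝒱.B * 𝒱.B) ?_ (Submodule.mul_mem_mul ha hb)
  rw [Submodule.mul_le]
  intro a ha b hb
  obtain ⟨⟨t, ht⟩, c, hc⟩ := 𝒱.B_le ha
  obtain ⟨⟨s, hs⟩, d, hd⟩ := 𝒱.B_le hb
  refine ⟨?_, d * c, by
    rw [Module.End.mul_apply, hd, LinearMap.map_smul_of_tower, hc, mul_smul]⟩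
  suffices h : ∃ x : ↥(𝒱.B * 𝒱.B) ⊗[ℂ] ↥(𝒱.B * 𝒱.B),
      TensorProduct.map (Submodule.subtype _) (Submodule.subtype _) x =
      TensorProduct.map (Submodule.subtype _) (Submodule.subtype _) t *
        TensorProduct.map (Submodule.subtype _) (Submodule.subtype _) s from
    by obtain ⟨x, hx⟩ := h; exact ⟨x, by rw [hx]; exact ht.mul hs⟩
  clear ht hs
  induction t with
  | zero => exact ⟨0, by rw [map_zero, map_zero, zero_mul]⟩
  | add x y hx hy =>
    obtain ⟨x', hx⟩ := hx
    obtain ⟨y', hy⟩ := hy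
    exact ⟨x' + y', by rw [map_add, map_add, add_mul, hx, hy]⟩
  | tmul b c =>
    induction s with
    | zero => exact ⟨0, by rw [map_zero, map_zero, mul_zero]⟩
    | add x y hx hy =>
      obtain ⟨x', hx⟩ := hx
      obtain ⟨y', hy⟩ := hy
      exact ⟨x' + y', by rw [map_add, map_add, mul_add, hx, hy]⟩
    | tmul b' c' =>
      exact ⟨⟨_, Submodule.mul_mem_mul b.2 b'.2⟩ ⊗ₜ ⟨_, Submodule.mul_mem_mul c.2 c'.2⟩, by
        simp only [TensorProduct.map_tmul, Submodule.subtype_apply,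
          Algebra.TensorProduct.tmul_mul_tmul]⟩

theorem ddx_vac {a : LaurentHom V} {c : ℂ}
    (h : a (1 ⊗ₜ 𝒱.vac) = c • ((1 : ScalarLaurent) ⊗ₜ[ℂ] 𝒱.vac)) :
    LaurentHom.ddx a (1 ⊗ₜ 𝒱.vac) = 0 := by
  rw [ddx_apply, h, map_smul, divDeriv_one_tmul 1 one_ne_zero, map_zero, smul_zero, sub_zero]

theorem ddx_mem_B {a : LaurentHom V} (ha : a ∈ 𝒱.B) : LaurentHom.ddx a ∈ 𝒱.B := by
  have h1 : 𝒱.B ≤ 𝒱.B ⊔ 𝒱.B.map ddxLinear := le_sup_left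
  have h2 : ∀ b ∈ 𝒱.B, ddxLinear b ∈ 𝒱.B ⊔ 𝒱.B.map ddxLinear := fun b hb =>
    Submodule.mem_sup_right (Submodule.mem_map_of_mem hb)
  -- The differentiated coproduct involves both b and ∂b, so B has to be included beside ∂B.
  refine 𝒱.le_B (U := 𝒱.B ⊔ 𝒱.B.map ddxLinear) ?_ (h2 a ha)
  refine sup_le (𝒱.B_le.trans (𝒱.coproductSubmodule_mono h1)) ?_
  rw [Submodule.map_le_iff_le_comap]
  intro a ha
  obtain ⟨⟨t, ht⟩, c, hc⟩ := 𝒱.B_le ha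
  refine ⟨?_, 0, by rw [zero_smul, ddxLinear_apply, 𝒱.ddx_vac hc]⟩
  let D : 𝒱.B →ₗ[ℂ] ↥(𝒱.B ⊔ 𝒱.B.map ddxLinear) :=
    (ddxLinear ∘ₗ 𝒱.B.subtype).codRestrict _ fun b => h2 b b.2
  let I : 𝒱.B →ₗ[ℂ] ↥(𝒱.B ⊔ 𝒱.B.map ddxLinear) := Submodule.inclusion h1
  refine ⟨TensorProduct.map D I t + TensorProduct.map I D t, ?_⟩
  have h3 := ht.ddx
  clear ht
  rw [ddxLinear_apply]
  convert h3 using 1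
  clear h3
  induction t with
  | zero => simp only [map_zero, add_zero]
  | tmul b c => rfl
  | add x y hx hy =>
    simp only [map_add] at hx hy ⊢
    rw [add_add_add_comm, hx, hy]
    exact add_add_add_comm _ _ _ _

end NonlocalVertexAlgebra

end Coproduct

/-! ### Coassociativity and counits -/

section Coalgebra

open LaurentHom

namespace NonlocalVertexAlgebra

variable {V : Type*} [AddCommGroup V] [Module ℂ V] (𝒱 : NonlocalVertexAlgebra V)
variable {A : Type*} [AddCommMonoid A] [Module ℂ A] (ρ : A →ₗ[ℂ] LaurentHom V)

/-- `coEval` on `A ⊗ A`, where `A` maps to `Hom(V, V ⊗ ℂ((x)))`. -/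
noncomputable def coEvalOn (u v : V) (j : ℤ) : A ⊗[ℂ] A →ₗ[ℂ] ScalarLaurent ⊗[ℂ] V :=
  𝒱.coEval (1 ⊗ₜ u) (1 ⊗ₜ v) j ∘ₗ TensorProduct.map ρ ρ

/-- Evaluation at a vector on `A`. -/
noncomputable def evalOn (v : V) : A →ₗ[ℂ] ScalarLaurent ⊗[ℂ] V :=
  eval (1 ⊗ₜ v) ∘ₗ ρ

theorem evalOn_apply (v : V) (a : A) : evalOn ρ v a = ρ a (1 ⊗ₜ v) := rfl

theorem coEvalOn_tmul (u v : V) (j : ℤ) (b c : A) :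
    𝒱.coEvalOn ρ u v j (b ⊗ₜ c) = 𝒱.shiftBilin j (evalOn ρ u b) (evalOn ρ v c) := rfl

variable {ρ}

theorem eq_of_evalOn_eq (hρ : Function.Injective ρ) {a b : A}
    (h : ∀ v, evalOn ρ v a = evalOn ρ v b) : a = b := hρ (ext_one_tmul h)

variable {𝒱} {δ : A →ₗ[ℂ] A ⊗[ℂ] A} {ε : A →ₗ[ℂ] ℂ}

/-- Put v = 𝟏 in the defining relation and take x₂⁰: Y(𝟏, x₂) = 1, and b(x)𝟏 = ε(b)𝟏. -/
theorem lid_rTensor_counit (hρ : Function.Injective ρ)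
    (hδ : ∀ a, 𝒱.IsCoproductTensor (ρ a) (TensorProduct.map ρ ρ (δ a)))
    (hε : ∀ a, ρ a (1 ⊗ₜ 𝒱.vac) = ε a • ((1 : ScalarLaurent) ⊗ₜ[ℂ] 𝒱.vac)) (a : A) :
    TensorProduct.lid ℂ A (ε.rTensor A (δ a)) = a := by
  have key : ∀ (v : V) (t : A ⊗[ℂ] A),
      evalOn ρ v (TensorProduct.lid ℂ A (ε.rTensor A t)) = 𝒱.coEvalOn ρ 𝒱.vac v 0 t := by
    intro v t
    induction t with
    | zero => simp only [map_zero]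
    | tmul b c =>
      rw [coEvalOn_tmul, LinearMap.rTensor_tmul, TensorProduct.lid_tmul, map_smul,
        evalOn_apply ρ 𝒱.vac, hε, map_smul, LinearMap.smul_apply, shiftBilin_vac_left]
    | add x y hx hy => simp only [map_add, hx, hy]
  refine eq_of_evalOn_eq hρ fun v => ?_
  have h := hδ a 𝒱.vac v 0
  rw [𝒱.vac_left, HahnSeries.coeff_single_same] at h
  rw [key]
  exact h.symm

/-- Put w = 𝟏 and take x₂⁰, where Y(v, x₂)𝟏 contributes v. -/
theorem rid_lTensor_counit (hρ : Function.Injective ρ)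
    (hδ : ∀ a, 𝒱.IsCoproductTensor (ρ a) (TensorProduct.map ρ ρ (δ a)))
    (hε : ∀ a, ρ a (1 ⊗ₜ 𝒱.vac) = ε a • ((1 : ScalarLaurent) ⊗ₜ[ℂ] 𝒱.vac)) (a : A) :
    TensorProduct.rid ℂ A (ε.lTensor A (δ a)) = a := by
  have key : ∀ (v : V) (t : A ⊗[ℂ] A),
      evalOn ρ v (TensorProduct.rid ℂ A (ε.lTensor A t)) = 𝒱.coEvalOn ρ v 𝒱.vac 0 t := by
    intro v t
    induction t with
    | zero => simp only [map_zero]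
    | tmul b c =>
      rw [coEvalOn_tmul, LinearMap.lTensor_tmul, TensorProduct.rid_tmul, map_smul,
        evalOn_apply ρ 𝒱.vac, hε, map_smul, shiftBilin_vac_right]
    | add x y hx hy => simp only [map_add, hx, hy]
  refine eq_of_evalOn_eq hρ fun v => ?_
  have h := hδ a v 𝒱.vac 0
  rw [𝒱.creation_zero] at h
  rw [key]
  exact h.symm

variable (𝒱 ρ)

/-- `∑ (b ⊗ c) ⊗ d ↦ ∑ Y(Y(b(x₁ - x₂ - x₀) u, x₀) c(x₁ - x₂) v, x₂) d(x₁) w`. -/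
noncomputable def iterEval (u v w : V) (i j : ℤ) :
    (A ⊗[ℂ] A) ⊗[ℂ] A →ₗ[ℂ] ScalarLaurent ⊗[ℂ] V :=
  𝒱.shiftTensor j ∘ₗ TensorProduct.map (𝒱.coEvalOn ρ u v i) (evalOn ρ w)

/-- `∑ b ⊗ (c ⊗ d) ↦ ∑ Y(b(x₁ - x₂) u, x₂) Y(c(x₁ - x₃) v, x₃) d(x₁) w`. -/
noncomputable def nestEval (u v w : V) (i j : ℤ) :
    A ⊗[ℂ] (A ⊗[ℂ] A) →ₗ[ℂ] ScalarLaurent ⊗[ℂ] V :=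
  𝒱.shiftTensor i ∘ₗ TensorProduct.map (evalOn ρ u) (𝒱.coEvalOn ρ v w j)

variable {ρ} in
-- `evalOn` separates the last factor and `coEvalOn` the first two; injectivity of the outer
-- operation combines them.
theorem eq_of_iterEval_eq (h𝒱 : 𝒱.Nondegenerate) (hρ : Function.Injective ρ)
    {t s : (A ⊗[ℂ] A) ⊗[ℂ] A}
    (h : ∀ u v w i j, 𝒱.iterEval ρ u v w i j t = 𝒱.iterEval ρ u v w i j s) : t = s := by
  refine eq_of_lTensor_eq (evalOn ρ) (fun x y hxy => eq_of_evalOn_eq hρ hxy) t s fun w => ?_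
  refine eq_of_rTensor_eq (fun p : V × V × ℤ => 𝒱.coEvalOn ρ p.1 p.2.1 p.2.2)
    (fun x y hxy => 𝒱.eq_of_coEval_eq h𝒱 hρ fun v w j => hxy (v, w, j)) _ _ fun p => ?_
  rw [← LinearMap.comp_apply, ← LinearMap.comp_apply, LinearMap.rTensor_comp_lTensor]
  exact 𝒱.eq_of_shiftTensor_eq h𝒱 fun j => h p.1 p.2.1 w p.2.2 j

variable {𝒱 ρ} in
-- The relation for δ is used twice, for the outer product with w and for the inner product of u and
-- v.
theorem iterEval_rTensor (hδ : ∀ a, 𝒱.IsCoproductTensor (ρ a) (TensorProduct.map ρ ρ (δ a)))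
    (u v w : V) (i j : ℤ) (a : A) :
    𝒱.iterEval ρ u v w i j (δ.rTensor A (δ a)) =
      evalOn ρ (iteratedProduct 𝒱.Y u v w i j) a := by
  have hc : ∀ (u v : V) (j : ℤ) (a : A),
      𝒱.coEvalOn ρ u v j (δ a) = evalOn ρ ((𝒱.Y u v).coeff j) a :=
    fun u v j a => (hδ a u v j).symm
  rw [iteratedProduct, ← hc]
  generalize δ a = t
  induction t with
  | zero => simp only [map_zero]
  | tmul b c =>
    rw [coEvalOn_tmul, ← hc u v i b]
    rfl
  | add x y hx hy => simp only [map_add, hx, hy]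

variable {𝒱 ρ} in
theorem nestEval_lTensor (hδ : ∀ a, 𝒱.IsCoproductTensor (ρ a) (TensorProduct.map ρ ρ (δ a)))
    (u v w : V) (i j : ℤ) (a : A) :
    𝒱.nestEval ρ u v w i j (δ.lTensor A (δ a)) =
      evalOn ρ (𝒱.nestedProduct u v w i j) a := by
  have hc : ∀ (u v : V) (j : ℤ) (a : A),
      𝒱.coEvalOn ρ u v j (δ a) = evalOn ρ ((𝒱.Y u v).coeff j) a :=
    fun u v j a => (hδ a u v j).symm
  rw [nestedProduct, ← hc]
  generalize δ a = t
  induction t with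
  | zero => simp only [map_zero]
  | tmul b c =>
    rw [coEvalOn_tmul, ← hc v w j c]
    rfl
  | add x y hx hy => simp only [map_add, hx, hy]

theorem iterEval_firstBounded (u v w : V)
    (t : (A ⊗[ℂ] A) ⊗[ℂ] A) :
    FirstBounded fun i j => 𝒱.iterEval ρ u v w i j t := by
  have hadd : ∀ x y : (A ⊗[ℂ] A) ⊗[ℂ] A,
      (FirstBounded fun i j => 𝒱.iterEval ρ u v w i j x) →
      (FirstBounded fun i j => 𝒱.iterEval ρ u v w i j y) →
      FirstBounded fun i j => 𝒱.iterEval ρ u v w i j (x + y) := by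
    rintro x y ⟨J, hJ⟩ ⟨J', hJ'⟩
    exact ⟨min J J', fun i j hi => by
      simp only [map_add, hJ i j (by lia), hJ' i j (by lia), add_zero]⟩
  induction t with
  | zero => exact ⟨0, fun i j _ => by simp only [map_zero]⟩
  | add x y hx hy => exact hadd x y hx hy
  | tmul x d =>
    induction x with
    | zero => exact ⟨0, fun i j _ => by simp only [TensorProduct.zero_tmul, map_zero]⟩
    | add x y hx hy => rw [TensorProduct.add_tmul]; exact hadd _ _ hx hy
    | tmul b c => exact 𝒱.iterShift_firstBounded (evalOn ρ u b) (evalOn ρ v c) (evalOn ρ w d)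

theorem weak_assoc_eval (u v w : V)
    (t : (A ⊗[ℂ] A) ⊗[ℂ] A) :
    (SecondBounded fun i j => 𝒱.nestEval ρ u v w i j (TensorProduct.assoc ℂ A A A t)) ∧
    ∃ l : ℕ, mulAddVars^[l]
        (expShift fun i j => 𝒱.nestEval ρ u v w i j (TensorProduct.assoc ℂ A A A t)) =
      mulAddVars^[l] fun i j => 𝒱.iterEval ρ u v w i j t := by
  set P : (A ⊗[ℂ] A) ⊗[ℂ] A → Prop := fun t =>
    (SecondBounded fun i j => 𝒱.nestEval ρ u v w i j (TensorProduct.assoc ℂ A A A t)) ∧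
    ∃ l : ℕ, mulAddVars^[l]
        (expShift fun i j => 𝒱.nestEval ρ u v w i j (TensorProduct.assoc ℂ A A A t)) =
      mulAddVars^[l] fun i j => 𝒱.iterEval ρ u v w i j t with hP
  have hzero : P 0 := by
    refine ⟨⟨0, fun i j _ => by simp only [map_zero]⟩, 0, ?_⟩
    funext i j
    simp only [Function.iterate_zero_apply, map_zero, expShift, smul_zero, finsum_zero]
  have hadd : ∀ x y, P x → P y → P (x + y) := by
    rintro x y ⟨hx, l, hl⟩ ⟨hy, l', hl'⟩
    have h1 := mulAddVars_iterate_eq_of_le (le_max_left l l') hl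
    have h2 := mulAddVars_iterate_eq_of_le (le_max_right l l') hl'
    have e1 : (fun i j => 𝒱.nestEval ρ u v w i j (TensorProduct.assoc ℂ A A A (x + y))) =
        (fun i j => 𝒱.nestEval ρ u v w i j (TensorProduct.assoc ℂ A A A x)) +
        fun i j => 𝒱.nestEval ρ u v w i j (TensorProduct.assoc ℂ A A A y) := by
      funext i j; simp only [map_add, Pi.add_apply]
    have e2 : (fun i j => 𝒱.iterEval ρ u v w i j (x + y)) =
        (fun i j => 𝒱.iterEval ρ u v w i j x) + fun i j => 𝒱.iterEval ρ u v w i j y := by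
      funext i j; simp only [map_add, Pi.add_apply]
    refine ⟨?_, max l l', ?_⟩
    · obtain ⟨J, hJ⟩ := hx
      obtain ⟨J', hJ'⟩ := hy
      exact ⟨min J J', fun i j hj => by
        simp only [map_add, hJ i j (by lia), hJ' i j (by lia), add_zero]⟩
    · rw [e1, e2, expShift_add hx hy]
      rw [mulAddVars_iterate (R := ℂ), mulAddVars_iterate (R := ℂ)] at h1 h2 ⊢
      rw [map_add, map_add, h1, h2]
  change P t
  induction t with
  | zero => exact hzero
  | add x y hx hy => exact hadd x y hx hy
  | tmul x d =>
    induction x with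
    | zero => rw [TensorProduct.zero_tmul]; exact hzero
    | add x y hx hy => rw [TensorProduct.add_tmul]; exact hadd _ _ hx hy
    | tmul b c =>
      exact ⟨𝒱.nestShift_secondBounded (evalOn ρ u b) (evalOn ρ v c) (evalOn ρ w d),
        𝒱.weak_assoc_shift (evalOn ρ u b) (evalOn ρ v c) (evalOn ρ w d)⟩

variable {𝒱 ρ}

theorem coassoc_apply (h𝒱 : 𝒱.Nondegenerate) (hρ : Function.Injective ρ)
    (hδ : ∀ a, 𝒱.IsCoproductTensor (ρ a) (TensorProduct.map ρ ρ (δ a))) (a : A) :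
    TensorProduct.assoc ℂ A A A (δ.rTensor A (δ a)) = δ.lTensor A (δ a) := by
  rw [← LinearEquiv.eq_symm_apply]
  set t₁ := δ.rTensor A (δ a) with ht₁
  set t₂ := (TensorProduct.assoc ℂ A A A).symm (δ.lTensor A (δ a)) with ht₂
  refine 𝒱.eq_of_iterEval_eq h𝒱 hρ fun u v w => ?_
  -- For t₂ the nested expansion is a applied to the nested product, so this relates t₂ to Y(u, x₁)
  -- Y(v, x₂)w.
  obtain ⟨-, l, hl⟩ := 𝒱.weak_assoc_eval ρ u v w t₂
  obtain ⟨l', hl'⟩ := 𝒱.weak_assoc u v w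
  simp only [ht₂, LinearEquiv.apply_symm_apply, nestEval_lTensor hδ] at hl
  rw [← ht₂] at hl
  let L : V →ₗ[ℂ] ScalarLaurent ⊗[ℂ] V :=
    (ρ a).restrictScalars ℂ ∘ₗ TensorProduct.mk ℂ ScalarLaurent V 1
  -- Weak associativity in V, transported by the operator ρ a, relates t₁ to the same nested
  -- product.
  have h1 : mulAddVars^[l'] (expShift fun i j => L (𝒱.nestedProduct u v w i j)) =
      mulAddVars^[l'] fun i j => 𝒱.iterEval ρ u v w i j t₁ := by
    simp only [ht₁, iterEval_rTensor hδ]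
    rw [expShift_map L (𝒱.nestedProduct_secondBounded u v w), mulAddVars_iterate_map,
      ← shiftedProduct_eq, hl', ← mulAddVars_iterate_map]
    rfl
  have h2 := (mulAddVars_iterate_eq_of_le (le_max_right l l') h1).symm.trans
    (mulAddVars_iterate_eq_of_le (le_max_left l l') hl)
  have h3 : (fun i j => 𝒱.iterEval ρ u v w i j t₁) - (fun i j => 𝒱.iterEval ρ u v w i j t₂) =
      0 := by
    refine eq_zero_of_mulAddVars_iterate (max l l')
      ((𝒱.iterEval_firstBounded ρ u v w _).sub (𝒱.iterEval_firstBounded ρ u v w _)) ?_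
    rw [mulAddVars_iterate (R := ℂ), mulAddVars_iterate (R := ℂ)] at h2
    rw [mulAddVars_iterate (R := ℂ), map_sub, h2, sub_self]
  exact fun i j => sub_eq_zero.mp (congrFun (congrFun h3 i) j)

theorem rTensor_counit_comp (hρ : Function.Injective ρ)
    (hδ : ∀ a, 𝒱.IsCoproductTensor (ρ a) (TensorProduct.map ρ ρ (δ a)))
    (hε : ∀ a, ρ a (1 ⊗ₜ 𝒱.vac) = ε a • ((1 : ScalarLaurent) ⊗ₜ[ℂ] 𝒱.vac)) :
    ε.rTensor A ∘ₗ δ = TensorProduct.mk ℂ ℂ A 1 :=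
  LinearMap.ext fun a => (TensorProduct.lid ℂ A).injective (by
    rw [LinearMap.comp_apply, lid_rTensor_counit hρ hδ hε, TensorProduct.mk_apply,
      TensorProduct.lid_tmul, one_smul])

theorem lTensor_counit_comp (hρ : Function.Injective ρ)
    (hδ : ∀ a, 𝒱.IsCoproductTensor (ρ a) (TensorProduct.map ρ ρ (δ a)))
    (hε : ∀ a, ρ a (1 ⊗ₜ 𝒱.vac) = ε a • ((1 : ScalarLaurent) ⊗ₜ[ℂ] 𝒱.vac)) :
    ε.lTensor A ∘ₗ δ = (TensorProduct.mk ℂ A ℂ).flip 1 :=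
  LinearMap.ext fun a => (TensorProduct.rid ℂ A).injective (by
    rw [LinearMap.comp_apply, rid_lTensor_counit hρ hδ hε, LinearMap.flip_apply,
      TensorProduct.mk_apply, TensorProduct.rid_tmul, one_smul])

theorem IsCoproductTensor.ddx_map {D : A →ₗ[ℂ] A} (hD : ∀ a, ρ (D a) = LaurentHom.ddx (ρ a))
    {a : A} {t : A ⊗[ℂ] A} (h : 𝒱.IsCoproductTensor (ρ a) (TensorProduct.map ρ ρ t)) :
    𝒱.IsCoproductTensor (ρ (D a)) (TensorProduct.map ρ ρ (D.rTensor A t + D.lTensor A t)) := by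
  have h1 : ρ ∘ₗ D = ddxLinear ∘ₗ ρ := LinearMap.ext hD
  have h2 := h.ddx
  rw [LinearMap.rTensor, LinearMap.lTensor, ← LinearMap.comp_apply, ← LinearMap.comp_apply,
    ← TensorProduct.map_comp, ← TensorProduct.map_comp, ← h1] at h2
  rw [hD, LinearMap.map_add, LinearMap.rTensor, LinearMap.lTensor, ← LinearMap.comp_apply,
    ← LinearMap.comp_apply, ← TensorProduct.map_comp, ← TensorProduct.map_comp]
  exact h2

end NonlocalVertexAlgebra

end Coalgebra

/-! ### The differential bialgebra `B(V)` -/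

section Bialgebra

open LaurentHom

namespace NonlocalVertexAlgebra

variable {V : Type*} [AddCommGroup V] [Module ℂ V] (𝒱 : NonlocalVertexAlgebra V)

/-- `B(V)` as a subalgebra. -/
noncomputable def subalgebraB : Subalgebra ℂ (LaurentHom V) :=
  𝒱.B.toSubalgebra 𝒱.one_mem_B fun _ _ => 𝒱.mul_mem_B

/-- The inclusion of `B(V)`. -/
noncomputable def inclB : 𝒱.subalgebraB →ₗ[ℂ] LaurentHom V := 𝒱.subalgebraB.val.toLinearMap

theorem inclB_injective : Function.Injective 𝒱.inclB := Subtype.val_injective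

theorem exists_comul (a : 𝒱.subalgebraB) : ∃ t : 𝒱.subalgebraB ⊗[ℂ] 𝒱.subalgebraB,
    𝒱.IsCoproductTensor a (TensorProduct.map 𝒱.inclB 𝒱.inclB t) :=
  (𝒱.B_le a.2).1

theorem exists_counit (a : 𝒱.subalgebraB) : ∃ c : ℂ,
    (a : LaurentHom V) (1 ⊗ₜ 𝒱.vac) = c • ((1 : ScalarLaurent) ⊗ₜ[ℂ] 𝒱.vac) :=
  (𝒱.B_le a.2).2

theorem vac_ne_zero [Nontrivial V] : 𝒱.vac ≠ 0 := fun h => by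
  obtain ⟨v, hv⟩ := exists_ne (0 : V)
  have h1 := congrArg (fun f : LaurentSeries V => f.coeff 0) (𝒱.vac_left v)
  rw [h] at h1
  simp only [map_zero, LinearMap.zero_apply, HahnSeries.coeff_zero,
    HahnSeries.coeff_single_same] at h1
  exact hv h1.symm

theorem one_tmul_vac_ne_zero [Nontrivial V] :
    ((1 : ScalarLaurent) ⊗ₜ[ℂ] 𝒱.vac) ≠ 0 := fun h => by
  have h1 := congrArg (TensorProduct.lid ℂ V ∘ (ScalarLaurent.coeffHom 0).rTensor V) h
  have h2 : ScalarLaurent.coeffHom 0 1 = 1 := by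
    rw [← map_one (algebraMap ℂ ScalarLaurent), ScalarLaurent.coeffHom_algebraMap, if_pos rfl]
  simp only [Function.comp_apply, LinearMap.rTensor_tmul, h2, TensorProduct.lid_tmul, one_smul,
    map_zero] at h1
  exact 𝒱.vac_ne_zero h1

theorem counit_unique [Nontrivial V] {a : LaurentHom V} {c d : ℂ}
    (hc : a (1 ⊗ₜ 𝒱.vac) = c • ((1 : ScalarLaurent) ⊗ₜ[ℂ] 𝒱.vac))
    (hd : a (1 ⊗ₜ 𝒱.vac) = d • ((1 : ScalarLaurent) ⊗ₜ[ℂ] 𝒱.vac)) : c = d :=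
  smul_left_injective ℂ 𝒱.one_tmul_vac_ne_zero (hc.symm.trans hd)

/-- The counit of `B(V)`. -/
noncomputable def counitFun (a : 𝒱.subalgebraB) : ℂ := (𝒱.exists_counit a).choose

theorem apply_vac (a : 𝒱.subalgebraB) :
    (a : LaurentHom V) (1 ⊗ₜ 𝒱.vac) = 𝒱.counitFun a • ((1 : ScalarLaurent) ⊗ₜ[ℂ] 𝒱.vac) :=
  (𝒱.exists_counit a).choose_spec

/-- The counit of `B(V)` as a linear map. -/
noncomputable def counitB [Nontrivial V] : 𝒱.subalgebraB →ₗ[ℂ] ℂ where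
  toFun := 𝒱.counitFun
  map_add' a b := 𝒱.counit_unique (𝒱.apply_vac (a + b)) (by
    rw [Subalgebra.coe_add, LinearMap.add_apply, 𝒱.apply_vac a, 𝒱.apply_vac b, add_smul])
  map_smul' c a := 𝒱.counit_unique (𝒱.apply_vac (c • a)) (by
    rw [Subalgebra.coe_smul, LinearMap.smul_apply, 𝒱.apply_vac a, RingHom.id_apply, smul_assoc])

/-- The comultiplication of `B(V)`. -/
noncomputable def comulFun (a : 𝒱.subalgebraB) : 𝒱.subalgebraB ⊗[ℂ] 𝒱.subalgebraB :=
  (𝒱.exists_comul a).choose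

theorem comulFun_spec (a : 𝒱.subalgebraB) :
    𝒱.IsCoproductTensor (𝒱.inclB a) (TensorProduct.map 𝒱.inclB 𝒱.inclB (𝒱.comulFun a)) :=
  (𝒱.exists_comul a).choose_spec

variable {𝒱}

theorem comulFun_eq_iff (h𝒱 : 𝒱.Nondegenerate) (a : 𝒱.subalgebraB)
    (t : 𝒱.subalgebraB ⊗[ℂ] 𝒱.subalgebraB) :
    𝒱.comulFun a = t ↔ 𝒱.IsCoproductTensor (𝒱.inclB a) (TensorProduct.map 𝒱.inclB 𝒱.inclB t) :=
  ⟨fun h => h ▸ 𝒱.comulFun_spec a, fun h => (𝒱.comulFun_spec a).unique h𝒱 𝒱.inclB_injective h⟩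

/-- The comultiplication of `B(V)` as a linear map. -/
noncomputable def comulB (h𝒱 : 𝒱.Nondegenerate) :
    𝒱.subalgebraB →ₗ[ℂ] 𝒱.subalgebraB ⊗[ℂ] 𝒱.subalgebraB where
  toFun := 𝒱.comulFun
  map_add' a b := (comulFun_eq_iff h𝒱 _ _).mpr (by
    rw [LinearMap.map_add, LinearMap.map_add]
    exact (𝒱.comulFun_spec a).add (𝒱.comulFun_spec b))
  map_smul' c a := (comulFun_eq_iff h𝒱 _ _).mpr (by
    rw [LinearMap.map_smul, LinearMap.map_smul]
    exact (𝒱.comulFun_spec a).smul c)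

variable (𝒱)

theorem map_inclB_mul (s t : 𝒱.subalgebraB ⊗[ℂ] 𝒱.subalgebraB) :
    TensorProduct.map 𝒱.inclB 𝒱.inclB (s * t) =
      TensorProduct.map 𝒱.inclB 𝒱.inclB s * TensorProduct.map 𝒱.inclB 𝒱.inclB t :=
  map_mul (Algebra.TensorProduct.map 𝒱.subalgebraB.val 𝒱.subalgebraB.val) s t

/-- The derivation `d/dx` of `B(V)`. -/
noncomputable def derB : 𝒱.subalgebraB →ₗ[ℂ] 𝒱.subalgebraB :=
  (ddxLinear ∘ₗ 𝒱.inclB).codRestrict (Subalgebra.toSubmodule 𝒱.subalgebraB)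
    fun a => 𝒱.ddx_mem_B a.2

theorem derB_apply (a : 𝒱.subalgebraB) : (𝒱.derB a : LaurentHom V) = LaurentHom.ddx a := rfl

/-- `B(V)` as a differential bialgebra. -/
noncomputable def differentialBialgebraB [Nontrivial V] (h𝒱 : 𝒱.Nondegenerate) :
    DifferentialBialgebra 𝒱.subalgebraB where
  comul := comulB h𝒱
  counit := 𝒱.counitB
  coassoc := LinearMap.ext (coassoc_apply h𝒱 𝒱.inclB_injective 𝒱.comulFun_spec)
  rTensor_counit_comp_comul := rTensor_counit_comp 𝒱.inclB_injective 𝒱.comulFun_spec 𝒱.apply_vac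
  lTensor_counit_comp_comul := lTensor_counit_comp 𝒱.inclB_injective 𝒱.comulFun_spec 𝒱.apply_vac
  comul_one := (comulFun_eq_iff h𝒱 _ _).mpr IsCoproductTensor.one
  comul_mul a b := (comulFun_eq_iff h𝒱 _ _).mpr (by
    rw [map_inclB_mul]
    exact (𝒱.comulFun_spec a).mul (𝒱.comulFun_spec b))
  counit_one := 𝒱.counit_unique (𝒱.apply_vac 1) (by
    rw [Subalgebra.coe_one, Module.End.one_apply, one_smul])
  counit_mul a b := 𝒱.counit_unique (𝒱.apply_vac (a * b)) (by
    rw [Subalgebra.coe_mul, Module.End.mul_apply, 𝒱.apply_vac b, LinearMap.map_smul_of_tower,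
      𝒱.apply_vac a, smul_smul, mul_comm]
    rfl)
  der := 𝒱.derB
  der_mul a b := Subtype.ext (ddx_mul (a : LaurentHom V) b)
  counit_der a := 𝒱.counit_unique (𝒱.apply_vac (𝒱.derB a)) (by
    rw [derB_apply, 𝒱.ddx_vac (𝒱.apply_vac a), zero_smul])
  comul_der a := (comulFun_eq_iff h𝒱 _ _).mpr
    ((𝒱.comulFun_spec a).ddx_map (D := 𝒱.derB) 𝒱.derB_apply)

/-! ### Primitive and group-like elements -/

variable {𝒱}

theorem mem_PDerMinus_iff (ψ : LaurentHom V) :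
    ψ ∈ 𝒱.PDerMinus ↔ 𝒱.IsCoproductTensor ψ (ψ ⊗ₜ 1 + 1 ⊗ₜ ψ) := by
  simp only [PDerMinus, Set.mem_ofPred_eq, IsCoproductTensor, map_add, coEval_tmul,
    Module.End.one_apply, shiftBilin_one_tmul, sub_eq_iff_eq_add]
  rfl

/-- At v = w = 𝟏 and x₂⁰ the relation reads ψ𝟏 = ψ𝟏 + ψ𝟏. -/
theorem apply_vac_of_mem_PDerMinus {ψ : LaurentHom V} (h : ψ ∈ 𝒱.PDerMinus) :
    ψ (1 ⊗ₜ 𝒱.vac) = 0 := by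
  have h1 := (mem_PDerMinus_iff ψ).mp h 𝒱.vac 𝒱.vac 0
  rw [𝒱.creation_zero, map_add, coEval_tmul, coEval_tmul, Module.End.one_apply,
    shiftBilin_vac_right, shiftBilin_vac_left] at h1
  exact left_eq_add.mp h1

theorem mem_B_of_mem_PDerMinus {ψ : LaurentHom V} (h : ψ ∈ 𝒱.PDerMinus) : ψ ∈ 𝒱.B := by
  have hψ : ψ ∈ Submodule.span ℂ {ψ, 1} := Submodule.subset_span (Set.mem_insert _ _)
  have h1 : (1 : LaurentHom V) ∈ Submodule.span ℂ {ψ, 1} :=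
    Submodule.subset_span (Set.mem_insert_of_mem _ rfl)
  refine 𝒱.le_B (U := Submodule.span ℂ {ψ, 1}) ?_ hψ
  rw [Submodule.span_le, Set.insert_subset_iff, Set.singleton_subset_iff]
  refine ⟨⟨⟨⟨ψ, hψ⟩ ⊗ₜ ⟨1, h1⟩ + ⟨1, h1⟩ ⊗ₜ ⟨ψ, hψ⟩, ?_⟩, 0, ?_⟩,
    ⟨⟨1, h1⟩ ⊗ₜ ⟨1, h1⟩, IsCoproductTensor.one⟩, 1, ?_⟩
  · rw [map_add]
    exact (mem_PDerMinus_iff ψ).mp h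
  · rw [apply_vac_of_mem_PDerMinus h, zero_smul]
  · rw [Module.End.one_apply, one_smul]

theorem mem_B_of_mem_PEndMinus {φ : LaurentHom V} (h : φ ∈ 𝒱.PEndMinus) : φ ∈ 𝒱.B := by
  have hφ : φ ∈ Submodule.span ℂ {φ} := Submodule.mem_span_singleton_self φ
  refine 𝒱.le_B (U := Submodule.span ℂ {φ}) ?_ hφ
  rw [Submodule.span_singleton_le_iff_mem]
  exact ⟨⟨⟨φ, hφ⟩ ⊗ₜ ⟨φ, hφ⟩, h.2⟩, 1, by rw [h.1, one_smul]⟩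

end NonlocalVertexAlgebra

end Bialgebra

open NonlocalVertexAlgebra in
theorem theorem3p8 {V : Type*} [AddCommGroup V] [Module ℂ V] [Nontrivial V]
    (𝒱 : NonlocalVertexAlgebra V) (h𝒱 : 𝒱.Nondegenerate) :
    ∃ S : Subalgebra ℂ (LaurentHom V), Subalgebra.toSubmodule S = 𝒱.B ∧
      ∃ D : DifferentialBialgebra S,
        (∀ a : S, (D.der a : LaurentHom V) = LaurentHom.ddx (a : LaurentHom V)) ∧
        (∀ (a : S) (c : ℂ),
          (a : LaurentHom V) (1 ⊗ₜ 𝒱.vac) = c • ((1 : ScalarLaurent) ⊗ₜ[ℂ] 𝒱.vac) ↔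
            D.counit a = c) ∧
        (∀ (a : S) (r : ℕ) (b c : Fin r → S),
          𝒱.IsCoproduct (a : LaurentHom V) (fun i => (b i : LaurentHom V))
              (fun i => (c i : LaurentHom V)) ↔
            D.comul a = ∑ i, b i ⊗ₜ[ℂ] c i) ∧
        𝒱.PDerMinus =
          {a | ∃ h : a ∈ S, D.comul ⟨a, h⟩ =
            (⟨a, h⟩ : S) ⊗ₜ[ℂ] (1 : S) + (1 : S) ⊗ₜ[ℂ] (⟨a, h⟩ : S)} ∧
        𝒱.PEndMinus =
          {a | a ≠ 0 ∧ ∃ h : a ∈ S, D.comul ⟨a, h⟩ = (⟨a, h⟩ : S) ⊗ₜ[ℂ] (⟨a, h⟩ : S)} := by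
  refine ⟨𝒱.subalgebraB, rfl, 𝒱.differentialBialgebraB h𝒱, fun a => rfl, fun a c => ?_,
    fun a r b c => ?_, Set.ext fun ψ => ?_, Set.ext fun φ => ?_⟩
  · exact ⟨fun h => 𝒱.counit_unique (𝒱.apply_vac a) h, fun h => h ▸ 𝒱.apply_vac a⟩
  · refine Iff.trans ?_ (comulFun_eq_iff h𝒱 a _).symm
    rw [isCoproduct_iff, map_sum]
    rfl
  · constructor
    · refine fun h => ⟨mem_B_of_mem_PDerMinus h, (comulFun_eq_iff h𝒱 _ _).mpr ?_⟩
      rw [map_add]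
      exact (mem_PDerMinus_iff ψ).mp h
    · rintro ⟨h, hc⟩
      have h1 := (comulFun_eq_iff h𝒱 _ _).mp hc
      rw [map_add] at h1
      exact (mem_PDerMinus_iff ψ).mpr h1
  · constructor
    · refine fun h => ⟨?_, mem_B_of_mem_PEndMinus h, (comulFun_eq_iff h𝒱 _ _).mpr h.2⟩
      rintro rfl
      exact 𝒱.one_tmul_vac_ne_zero h.1.symm
    · rintro ⟨h0, h, hc⟩
      refine ⟨?_, (comulFun_eq_iff h𝒱 _ _).mp hc⟩
      -- The counit identity gives ε(φ)φ = φ. As φ ≠ 0, this forces ε(φ) = 1, which is the condition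
      -- φ(x)𝟏 = 𝟏.
      have h1 := lid_rTensor_counit (ε := 𝒱.counitB) (δ := comulB h𝒱) 𝒱.inclB_injective
        𝒱.comulFun_spec 𝒱.apply_vac ⟨φ, h⟩
      rw [show comulB h𝒱 ⟨φ, h⟩ = _ from hc, LinearMap.rTensor_tmul, TensorProduct.lid_tmul] at h1
      have h2 : 𝒱.counitB ⟨φ, h⟩ = 1 := by
        obtain ⟨x, hx⟩ := DFunLike.ne_iff.mp h0
        refine smul_left_injective ℂ hx ?_
        exact (congrArg (fun a : 𝒱.subalgebraB => (a : LaurentHom V) x) h1).trans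
          (one_smul ℂ (φ x)).symm
      have h4 : φ (1 ⊗ₜ 𝒱.vac) = 𝒱.counitB ⟨φ, h⟩ • _ := 𝒱.apply_vac ⟨φ, h⟩
      rwa [h2, one_smul] at h4
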